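/- There is an integer $N$ such that the following hold for every $n \ge N$. (1) Let $d > n^{-1/200}$ be real, and let the complete bipartite graph $K_{n,n}$ be properly edge-coloured (distinct edges sharing a vertex receive distinct colours) so that at least $dn^2$ colours are used. Then there is a rainbow perfect matching, that is, a perfect matching of $K_{n,n}$ whose edges have pairwise distinct colours. (2) Call an $n \times n$ array filled with symbols a Latin array of order $n$ if every symbol appears at most once in each row and at most once in each column, and call a set of cells a transversal if it contains exactly one cell from each row, exactly one cell from each column, and no two cells with the same symbol. Every Latin array of order $n$ in which at least $n^{399/200}$ distinct symbols appear has a transversal. (3) In particular (the Akbari–Alipour conjecture for large $n$), every Latin array of order $n$ in which at least $n^2/2$ distinct symbols appear has a transversal. -/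

import Mathlib

/-- A perfect matching of `G` all of whose edges receive pairwise distinct colours. A proper
edge-colouring of `G` is a proper vertex-colouring of its line graph: distinct edges that share
an endpoint receive distinct colours. -/
def IsRainbowPerfectMatching {V α : Type*} {G : SimpleGraph V} (c : G.lineGraph.Coloring α)
    (M : G.Subgraph) : Prop :=
  M.IsPerfectMatching ∧ Set.InjOn c {e : G.edgeSet | (e : Sym2 V) ∈ M.edgeSet}

/-- A Latin array of order `n`: an `n × n` array in which every symbol appears at most once in
each row and at most once in each column. -/
def IsLatinArray {n : ℕ} {α : Type*} (L : Matrix (Fin n) (Fin n) α) : Prop :=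
  (∀ i, Function.Injective fun j => L i j) ∧ (∀ j, Function.Injective fun i => L i j)

/-- The set of symbols that occur in an array. -/
def arraySymbols {n : ℕ} {α : Type*} (L : Matrix (Fin n) (Fin n) α) : Set α :=
  Set.range fun p : Fin n × Fin n => L p.1 p.2

/-- A transversal: a set of cells that uses every row exactly once and every column exactly once,
with no symbol repeated. -/
def IsTransversal {n : ℕ} {α : Type*} (L : Matrix (Fin n) (Fin n) α)
    (T : Set (Fin n × Fin n)) : Prop :=
  (∀ i, ∃! j, (i, j) ∈ T) ∧ (∀ j, ∃! i, (i, j) ∈ T) ∧ Set.InjOn (fun p => L p.1 p.2) T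

/-!
Let `μ` be a small constant times the square of the proportion `d` of colours to cells. A random set
`U` of colours of density `μ` behaves, on the cells of a proper colouring, like a random set of
cells: fourth moments control the number of its cells on each line, and the Cauchy–Schwarz
inequality reduces its discrepancy on all rectangles at once to a sum over 4-cycles. As there are
many colours, most of them are rare, and one cell for each rare colour outside `U` gives a dense
set of cells of distinct colours, in which one finds a matching richly linked by the remaining
cells. The switching argument of Woolbright and of Brouwer, de Vries and Wieringa augments a
rainbow matching on both halves of the array while the linking cells join the two halves, so that
a largest rainbow matching avoiding `U` misses only `O(μ⁻²)` rows. Each missing row and column is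
then absorbed by a rotation, which trades two cells of the matching for three cells with colours
of `U`; the expansion of `U` supplies the rotation.
-/

section RainbowMatchings

open Finset

section Images

variable {κ ι : Type*} [DecidableEq κ] [DecidableEq ι] {f : κ → ι} {M N : Finset κ}

lemma notMem_image_erase_of_injOn {p : κ} (hf : Set.InjOn f (M : Set κ)) (hp : p ∈ M) :
    f p ∉ (M.erase p).image f := by
  simp only [mem_image, mem_erase, not_exists, not_and, and_imp]
  exact fun q hq hqM e => hq (hf hqM hp e)

lemma injOn_union_of_disjoint_image (hM : Set.InjOn f (M : Set κ)) (hN : Set.InjOn f (N : Set κ))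
    (h : Disjoint (M.image f) (N.image f)) : Set.InjOn f ((M ∪ N : Finset κ) : Set κ) := by
  rw [coe_union, Set.injOn_union (disjoint_coe.2 (Disjoint.of_image_finset h))]
  exact ⟨hM, hN, fun p hp q hq e =>
    disjoint_left.1 h (mem_image_of_mem f hp) (e ▸ mem_image_of_mem f hq)⟩

lemma disjoint_image_of_subset_union {N' P : Finset κ} {D : Finset ι}
    (hf : Set.InjOn f ((N ∪ P : Finset κ) : Set κ)) (hNP : Disjoint N P)
    (hN' : N'.image f ⊆ N.image f ∪ D) (hD : Disjoint D (P.image f)) :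
    Disjoint (N'.image f) (P.image f) := by
  refine (disjoint_union_left.2 ⟨?_, hD⟩).mono_left hN'
  rw [disjoint_iff_inter_eq_empty, ← image_inter_of_injOn _ _ (by rwa [← coe_union]),
    disjoint_iff_inter_eq_empty.1 hNP, image_empty]

omit [DecidableEq κ] in
lemma card_inter_image_le {V : Finset ι} : #(V ∩ M.image f) ≤ #{p ∈ M | f p ∈ V} := by
  rw [inter_comm, ← filter_mem_eq_inter, filter_image]
  exact card_image_le

end Images

/-- A proper colouring of the cells of an array: the lines of the array are rainbow. -/
structure IsProper {A B α : Type*} (c : A × B → α) : Prop where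
  row : ∀ a, Function.Injective fun b => c (a, b)
  col : ∀ b, Function.Injective fun a => c (a, b)

lemma IsProper.swap {A B α : Type*} {c : A × B → α} (hc : IsProper c) :
    IsProper fun p : B × A => c p.swap :=
  ⟨hc.col, hc.row⟩

/-- A rainbow matching: a set of cells no two of which share a row, a column or a colour. -/
structure IsRainbow {A B α : Type*} (c : A × B → α) (M : Finset (A × B)) : Prop where
  injOn_fst : Set.InjOn Prod.fst (M : Set (A × B))
  injOn_snd : Set.InjOn Prod.snd (M : Set (A × B))
  injOn_color : Set.InjOn c (M : Set (A × B))

namespace IsRainbow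

variable {A B α : Type*} {c : A × B → α} {M N : Finset (A × B)}

lemma mono (h : IsRainbow c M) (hNM : N ⊆ M) : IsRainbow c N :=
  ⟨h.injOn_fst.mono (coe_subset.2 hNM), h.injOn_snd.mono (coe_subset.2 hNM),
    h.injOn_color.mono (coe_subset.2 hNM)⟩

lemma card_le [Fintype A] (h : IsRainbow c M) : #M ≤ Fintype.card A :=
  card_le_card_of_injOn Prod.fst (fun _ _ => mem_univ _) h.injOn_fst

variable [DecidableEq A] [DecidableEq B] [DecidableEq α]

lemma insert {p : A × B} (h : IsRainbow c M) (h₁ : p.1 ∉ M.image Prod.fst)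
    (h₂ : p.2 ∉ M.image Prod.snd) (h₃ : c p ∉ M.image c) : IsRainbow c (insert p M) := by
  have hp : p ∉ (M : Set (A × B)) := fun hp => h₁ (mem_image_of_mem _ hp)
  simp only [← mem_coe, coe_image] at h₁ h₂ h₃
  constructor <;> rw [coe_insert, Set.injOn_insert hp]
  exacts [⟨h.injOn_fst, h₁⟩, ⟨h.injOn_snd, h₂⟩, ⟨h.injOn_color, h₃⟩]

lemma union (hM : IsRainbow c M) (hN : IsRainbow c N)
    (h₁ : Disjoint (M.image Prod.fst) (N.image Prod.fst))
    (h₂ : Disjoint (M.image Prod.snd) (N.image Prod.snd))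
    (h₃ : Disjoint (M.image c) (N.image c)) : IsRainbow c (M ∪ N) :=
  ⟨injOn_union_of_disjoint_image hM.injOn_fst hN.injOn_fst h₁,
    injOn_union_of_disjoint_image hM.injOn_snd hN.injOn_snd h₂,
    injOn_union_of_disjoint_image hM.injOn_color hN.injOn_color h₃⟩

end IsRainbow

lemma IsRainbow.image_swap {A B α : Type*} [DecidableEq A] [DecidableEq B] {c : A × B → α}
    {M : Finset (A × B)} (h : IsRainbow c M) :
    IsRainbow (fun p : B × A => c p.swap) (M.image Prod.swap) := by
  constructor <;> rw [coe_image] <;> apply Set.InjOn.image_of_comp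
  exacts [h.injOn_snd, h.injOn_fst, by simpa [Function.comp_def] using h.injOn_color]

/-- `N'` is an augmentation of the rainbow matching `N`: it has one more cell, its rows and columns
are those of `N` up to rows of `D` and columns of `E`, and it has at most one new colour, which lies
outside `Z`. -/
structure IsAugmentation {A B α : Type*} [DecidableEq A] [DecidableEq B] [DecidableEq α]
    (c : A × B → α) (N : Finset (A × B)) (D : Finset A) (E : Finset B) (Z : Finset α)
    (N' : Finset (A × B)) : Prop where
  rainbow : IsRainbow c N'
  card_eq : #N' = #N + 1
  rows : N'.image Prod.fst ⊆ N.image Prod.fst ∪ D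
  cols : N'.image Prod.snd ⊆ N.image Prod.snd ∪ E
  colors : ∃ u ∉ Z, N'.image c ⊆ insert u (N.image c)

section Switching

variable {A B α : Type*} [DecidableEq A] [DecidableEq B] [DecidableEq α] {c : A × B → α}
  {N N' F F' : Finset (A × B)} {D D' : Finset A} {Z : Finset α} {γ : α} {a : A} {y : B}

/-- The colour `γ` can be freed by a switching of the rainbow matching `N`: moving only cells of
`F`, into rows of `D`, one gets a matching `N'` on the same columns which avoids `γ`. The last
condition leaves room to add a cell of colour `γ` to `N'` at the cost of at most one colour that is
new for `N`, and that colour lies outside `Z`. -/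
structure IsSwitching (c : A × B → α) (N : Finset (A × B)) (D : Finset A) (Z : Finset α)
    (F : Finset (A × B)) (γ : α) (N' : Finset (A × B)) : Prop where
  rainbow : IsRainbow c N'
  card_eq : #N' = #N
  rows : N'.image Prod.fst ⊆ N.image Prod.fst ∪ D
  cols : N'.image Prod.snd = N.image Prod.snd
  moved : N \ N' ⊆ F
  freed : γ ∉ N'.image c
  colors : ∃ u ∉ Z, insert γ (N'.image c) ⊆ insert u (N.image c)

namespace IsSwitching

lemma refl (hN : IsRainbow c N) (hγZ : γ ∉ Z) (hγ : γ ∉ N.image c) : IsSwitching c N D Z F γ N :=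
  ⟨hN, rfl, subset_union_left, rfl, by simp, hγ, γ, hγZ, subset_rfl⟩

lemma mono (h : IsSwitching c N D Z F γ N') (hD : D ⊆ D') (hF : F ⊆ F') :
    IsSwitching c N D' Z F' γ N' :=
  { h with
    rows := h.rows.trans (union_subset_union_right hD)
    moved := h.moved.trans hF }

lemma isAugmentation (h : IsSwitching c N D Z F (c (a, y)) N') (ha : a ∉ N.image Prod.fst ∪ D)
    (hy : y ∉ N.image Prod.snd) : IsAugmentation c N (insert a D) {y} Z (insert (a, y) N') := by
  have ha' : a ∉ N'.image Prod.fst := fun h' => ha (h.rows h')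
  obtain ⟨u, huZ, hu⟩ := h.colors
  refine ⟨h.rainbow.insert ha' (h.cols ▸ hy) h.freed, ?_, ?_, ?_, u, huZ, ?_⟩
  · rw [card_insert_of_notMem fun h' => ha' (mem_image_of_mem _ h'), h.card_eq]
  · rw [image_insert, union_insert]
    exact insert_subset_insert _ h.rows
  · rw [image_insert, h.cols, union_comm, insert_eq]
  · rwa [image_insert]

lemma exchange {e : A × B} (h : IsSwitching c N D Z F (c (a, e.2)) N')
    (ha : a ∉ N.image Prod.fst ∪ D) (he : e ∈ N) (heF : e ∉ F) :
    IsSwitching c N (insert a D) Z (insert e F) (c e) (insert (a, e.2) (N'.erase e)) := by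
  have he' : e ∈ N' := by
    by_contra he'
    exact heF (h.moved (mem_sdiff.2 ⟨he, he'⟩))
  have ha' : a ∉ (N'.erase e).image Prod.fst :=
    fun h' => ha (h.rows (image_subset_image (erase_subset _ _) h'))
  have hne : c e ≠ c (a, e.2) := fun h' => h.freed (h' ▸ mem_image_of_mem _ he')
  obtain ⟨u, huZ, hu⟩ := h.colors
  rw [insert_subset_iff] at hu
  refine ⟨(h.rainbow.mono (erase_subset _ _)).insert ha'
    (notMem_image_erase_of_injOn h.rainbow.injOn_snd he')
    fun h' => h.freed (image_subset_image (erase_subset _ _) h'), ?_, ?_, ?_, ?_, ?_, u, huZ, ?_⟩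
  · rw [card_insert_of_notMem fun h' => ha' (mem_image_of_mem _ h'), card_erase_add_one he',
      h.card_eq]
  · rw [image_insert, union_insert]
    exact insert_subset_insert _ ((image_subset_image (erase_subset _ _)).trans h.rows)
  · rw [image_insert, ← image_insert (f := Prod.snd) (a := e), insert_erase he', h.cols]
  · rw [sdiff_insert, sdiff_erase he]
    exact (erase_subset _ _).trans (insert_subset_insert _ h.moved)
  · rw [image_insert, mem_insert, not_or]
    exact ⟨hne, notMem_image_erase_of_injOn h.rainbow.injOn_color he'⟩
  · rw [image_insert]
    exact insert_subset (mem_insert_of_mem (mem_image_of_mem _ he)) (insert_subset hu.1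
      ((image_subset_image (erase_subset _ _)).trans hu.2))

end IsSwitching

variable [Fintype B]

lemma card_add_card_le_card_filter_notMem (hc : Function.Injective fun b => c (a, b)) (hF : F ⊆ N)
    {t : ℕ} (hZ : #{b | c (a, b) ∈ Z} ≤ t) :
    Fintype.card B + #F ≤ #{b | c (a, b) ∉ Z ∧ c (a, b) ∉ (N \ F).image c} + t + #N := by
  have hNF : #{b | c (a, b) ∈ (N \ F).image c} + #F ≤ #N := by
    rw [← card_sdiff_add_card_eq_card hF]
    refine Nat.add_le_add_right (le_trans ?_ (card_image_le (f := c))) _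
    exact card_le_card_of_injOn (fun b => c (a, b)) (fun b hb => by simpa using hb) hc.injOn
  have hcover : (univ : Finset B) = ({b | c (a, b) ∉ Z ∧ c (a, b) ∉ (N \ F).image c} : Finset B) ∪
      (({b | c (a, b) ∈ Z} : Finset B) ∪ ({b | c (a, b) ∈ (N \ F).image c} : Finset B)) := by
    ext b
    simp only [mem_union, mem_filter, mem_univ, true_and]
    tauto
  have h₁ := (congrArg card hcover).le.trans (card_union_le _ _)
  have h₂ := card_union_le ({b | c (a, b) ∈ Z} : Finset B) {b | c (a, b) ∈ (N \ F).image c}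
  rw [card_univ] at h₁
  omega

lemma exists_isSwitching_insert_or_exists_isAugmentation
    (hc : Function.Injective fun b => c (a, b)) (hN : IsRainbow c N) (hF : F ⊆ N)
    (ha : a ∉ N.image Prod.fst ∪ D) {t g : ℕ} (hZ : #{b | c (a, b) ∈ Z} ≤ t)
    (hfree : ∀ e ∈ F, ∃ N', IsSwitching c N D Z F (c e) N') :
    (∃ F' ⊆ N, #F + g ≤ #F' ∧ ∀ e ∈ F', ∃ N', IsSwitching c N (insert a D) Z F' (c e) N') ∨
      ∃ S : Finset B, Fintype.card B ≤ #S + t + #N + g ∧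
        ∀ y ∈ S, ∃ N', IsAugmentation c N (insert a D) {y} Z N' := by
  set V : Finset B := {b | c (a, b) ∉ Z ∧ c (a, b) ∉ (N \ F).image c}
  have hV : Fintype.card B + #F ≤ #V + t + #N := card_add_card_le_card_filter_notMem hc hF hZ
  have hbase : ∀ b ∈ V, ∃ N', IsSwitching c N D Z F (c (a, b)) N' := by
    intro b hb
    obtain ⟨hbZ, hbF⟩ : c (a, b) ∉ Z ∧ c (a, b) ∉ (N \ F).image c := by simpa [V] using hb
    by_cases hbN : c (a, b) ∈ N.image c
    · obtain ⟨e, he, hec⟩ := mem_image.1 hbN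
      refine hec ▸ hfree e ?_
      by_contra heF
      exact hbF (mem_image.2 ⟨e, mem_sdiff.2 ⟨he, heF⟩, hec⟩)
    · exact ⟨N, .refl hN hbZ hbN⟩
  by_cases hsmall : Fintype.card B ≤ #(V \ N.image Prod.snd) + t + #N + g
  · refine .inr ⟨V \ N.image Prod.snd, hsmall, fun y hy => ?_⟩
    obtain ⟨hyV, hyN⟩ := mem_sdiff.1 hy
    obtain ⟨N', hN'⟩ := hbase y hyV
    exact ⟨_, hN'.isAugmentation ha hyN⟩
  · refine .inl ⟨F ∪ {e ∈ N | e.2 ∈ V}, union_subset hF (filter_subset _ _), ?_, fun e he => ?_⟩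
    · have h₁ := card_sdiff_add_card_inter V (N.image Prod.snd)
      have h₂ := (card_inter_image_le (V := V)).trans
        (card_le_card (subset_union_right (s₁ := F) (s₂ := {e ∈ N | e.2 ∈ V})))
      omega
    · by_cases heF : e ∈ F
      · obtain ⟨N', hN'⟩ := hfree e heF
        exact ⟨N', hN'.mono (subset_insert _ _) subset_union_left⟩
      · have heV : e ∈ {e ∈ N | e.2 ∈ V} := (mem_union.1 he).resolve_left heF
        obtain ⟨heN, heV⟩ := mem_filter.1 heV
        obtain ⟨N', hN'⟩ := hbase e.2 heV
        exact ⟨_, (hN'.exchange ha heN heF).mono subset_rfl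
          (insert_subset he subset_union_left)⟩

/-- The switching argument of Woolbright and of Brouwer, de Vries and Wieringa: each row of `D` in
turn either yields the augmentations or makes `g` more cells of `N` movable. -/
theorem exists_isAugmentation_of_card_lt (hc : IsProper c) (hN : IsRainbow c N)
    (hD : Disjoint D (N.image Prod.fst)) {t g : ℕ} (hZ : ∀ a ∈ D, #{b | c (a, b) ∈ Z} ≤ t)
    (hcard : #N < #D * g) :
    ∃ S : Finset B, Fintype.card B ≤ #S + t + #N + g ∧ ∀ y ∈ S, ∃ N',
      IsAugmentation c N D {y} Z N' := by
  by_contra hcon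
  suffices h : ∀ D' ⊆ D, ∃ F ⊆ N, #D' * g ≤ #F ∧ ∀ e ∈ F, ∃ N', IsSwitching c N D' Z F (c e) N' by
    obtain ⟨F, hF, h, -⟩ := h D subset_rfl
    exact absurd (card_le_card hF) (by omega)
  intro D'
  induction D' using Finset.induction_on with
  | empty => exact fun _ => ⟨∅, by simp, by simp, by simp⟩
  | insert a D' ha ih =>
    intro hD'
    have haD : a ∈ D := hD' (mem_insert_self _ _)
    obtain ⟨F, hF, hFcard, hfree⟩ := ih ((subset_insert _ _).trans hD')
    have ha' : a ∉ N.image Prod.fst ∪ D' := by simp [mem_union, disjoint_left.1 hD haD, ha]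
    obtain ⟨F', hF', hF'card, hfree'⟩ | ⟨S, hS, haug⟩ :=
      exists_isSwitching_insert_or_exists_isAugmentation (g := g) (hc.row a) hN hF ha'
        (hZ a haD) hfree
    · refine ⟨F', hF', ?_, hfree'⟩
      rw [card_insert_of_notMem ha, add_mul, one_mul]
      omega
    · refine absurd ⟨S, hS, fun y hy => ?_⟩ hcon
      obtain ⟨N', hN'⟩ := haug y hy
      exact ⟨N', { hN' with rows := hN'.rows.trans (union_subset_union_right hD') }⟩

end Switching

section RandomSubset

variable {α : Type*}

/-- Expectation over a random subset of `Γ` that contains each element independently with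
probability `μ`. -/
noncomputable def randomMean (Γ : Finset α) (μ : ℝ) (F : Finset α → ℝ) : ℝ :=
  ∑ U ∈ Γ.powerset, μ ^ #U * (1 - μ) ^ (#Γ - #U) * F U

variable {Γ : Finset α} {μ : ℝ}

lemma randomMean_const (C : ℝ) : randomMean Γ μ (fun _ => C) = C := by
  rw [randomMean, ← sum_mul, sum_pow_mul_eq_add_pow]; simp

lemma randomMean_add (F G : Finset α → ℝ) :
    randomMean Γ μ (fun U => F U + G U) = randomMean Γ μ F + randomMean Γ μ G := by
  simp only [randomMean, mul_add, sum_add_distrib]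

lemma randomMean_mul_const (F : Finset α → ℝ) (C : ℝ) :
    randomMean Γ μ (fun U => F U * C) = randomMean Γ μ F * C := by
  simp only [randomMean, sum_mul, mul_assoc]

lemma randomMean_sum {ι : Type*} (s : Finset ι) (F : ι → Finset α → ℝ) :
    randomMean Γ μ (fun U => ∑ i ∈ s, F i U) = ∑ i ∈ s, randomMean Γ μ (F i) := by
  simp only [randomMean, mul_sum]
  exact sum_comm

lemma randomMean_mono (h₀ : 0 ≤ μ) (h₁ : μ ≤ 1) {F G : Finset α → ℝ} (h : ∀ U ⊆ Γ, F U ≤ G U) :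
    randomMean Γ μ F ≤ randomMean Γ μ G :=
  sum_le_sum fun U hU => mul_le_mul_of_nonneg_left (h U (mem_powerset.1 hU))
    (mul_nonneg (pow_nonneg h₀ _) (pow_nonneg (sub_nonneg.2 h₁) _))

lemma exists_le_of_randomMean_le (h₀ : 0 < μ) (h₁ : μ < 1) {F : Finset α → ℝ} {C : ℝ}
    (h : randomMean Γ μ F ≤ C) : ∃ U ⊆ Γ, F U ≤ C := by
  by_contra! hcon
  have : randomMean Γ μ (fun _ => C) < randomMean Γ μ F :=
    sum_lt_sum_of_nonempty ⟨∅, by simp⟩ fun U hU =>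
      mul_lt_mul_of_pos_left (hcon U (mem_powerset.1 hU))
        (mul_pos (pow_pos h₀ _) (pow_pos (sub_pos.2 h₁) _))
  rw [randomMean_const] at this
  linarith

variable [DecidableEq α]

/-- The centred indicator of the event that `γ` lies in the random set. -/
noncomputable def centred (μ : ℝ) (U : Finset α) (γ : α) : ℝ := (if γ ∈ U then 1 else 0) - μ

lemma randomMean_centred_mul {γ : α} (hγ : γ ∈ Γ) {F : Finset α → ℝ}
    (hF : ∀ U, F (insert γ U) = F U) : randomMean Γ μ (fun U => centred μ U γ * F U) = 0 := by
  obtain ⟨Δ, hΔ, rfl⟩ : ∃ Δ, γ ∉ Δ ∧ insert γ Δ = Γ :=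
    ⟨Γ.erase γ, notMem_erase _ _, insert_erase hγ⟩
  rw [randomMean, sum_powerset_insert hΔ, ← sum_add_distrib]
  refine sum_eq_zero fun U hU => ?_
  rw [mem_powerset] at hU
  have hγU : γ ∉ U := fun h => hΔ (hU h)
  rw [card_insert_of_notMem hΔ, card_insert_of_notMem hγU, hF, centred, centred,
    if_neg hγU, if_pos (mem_insert_self _ _), Nat.add_sub_add_right,
    Nat.sub_add_comm (card_le_card hU)]
  ring

lemma centred_insert {γ δ : α} (h : δ ≠ γ) (U : Finset α) :
    centred μ (insert γ U) δ = centred μ U δ := by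
  simp [centred, mem_insert, h]

lemma abs_centred_le (h₀ : 0 ≤ μ) (h₁ : μ ≤ 1) (U : Finset α) (γ : α) : |centred μ U γ| ≤ 1 := by
  rw [centred, abs_le]; split_ifs <;> constructor <;> linarith

omit [DecidableEq α] in
lemma randomMean_card : randomMean Γ μ (fun U => (#U : ℝ)) = μ * #Γ := by
  classical
  have hmem : ∀ γ ∈ Γ, randomMean Γ μ (fun U => if γ ∈ U then 1 else 0) = μ := by
    intro γ hγ
    calc randomMean Γ μ (fun U => if γ ∈ U then 1 else 0)
        = randomMean Γ μ (fun U => centred μ U γ * 1 + μ) := by simp [centred]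
      _ = μ := by
        rw [randomMean_add, randomMean_centred_mul hγ fun _ => rfl, randomMean_const, zero_add]
  calc randomMean Γ μ (fun U => (#U : ℝ))
      = randomMean Γ μ (fun U => ∑ γ ∈ Γ, if γ ∈ U then 1 else 0) := by
        refine sum_congr rfl fun U hU => ?_
        beta_reduce
        rw [sum_boole, filter_mem_eq_inter, inter_eq_right.2 (mem_powerset.1 hU)]
    _ = μ * #Γ := by
        rw [randomMean_sum, sum_congr rfl hmem, sum_const, nsmul_eq_mul, mul_comm]

omit [DecidableEq α] in
lemma exists_card_le_of_randomMean_le (h₀ : 0 < μ) (h₁ : μ < 1) (hΓ : Γ.Nonempty)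
    {F : Finset α → ℝ} (hF : ∀ U, 0 ≤ F U) {C : ℝ} (hC : 0 < C) (h : randomMean Γ μ F ≤ C) :
    ∃ U ⊆ Γ, (#U : ℝ) ≤ 2 * μ * #Γ ∧ F U ≤ 2 * C := by
  have hm : 0 < μ * #Γ := mul_pos h₀ (Nat.cast_pos.2 hΓ.card_pos)
  have hmean : randomMean Γ μ (fun U => F U * (μ * #Γ) + #U * C) ≤ 2 * C * (μ * #Γ) := by
    rw [randomMean_add, randomMean_mul_const, randomMean_mul_const, randomMean_card]
    nlinarith
  obtain ⟨U, hU, hle⟩ := exists_le_of_randomMean_le h₀ h₁ hmean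
  have hFU : 0 ≤ F U * (μ * #Γ) := mul_nonneg (hF U) hm.le
  have hUC : 0 ≤ #U * C := by positivity
  exact ⟨U, hU, le_of_mul_le_mul_right (by linarith) hC, le_of_mul_le_mul_right (by linarith) hm⟩

lemma randomMean_four_centred_eq_zero {γ₁ γ₂ γ₃ γ₄ : α} (m₁ : γ₁ ∈ Γ) (h₂ : γ₂ ≠ γ₁) (h₃ : γ₃ ≠ γ₁)
    (h₄ : γ₄ ≠ γ₁) : randomMean Γ μ
      (fun U => centred μ U γ₁ * (centred μ U γ₂ * centred μ U γ₃ * centred μ U γ₄)) = 0 :=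
  randomMean_centred_mul m₁ fun U => by
    rw [centred_insert h₂, centred_insert h₃, centred_insert h₄]

lemma randomMean_four_centred_le (h₀ : 0 ≤ μ) (h₁ : μ ≤ 1) {γ₁ γ₂ γ₃ γ₄ : α} (m₁ : γ₁ ∈ Γ)
    (m₂ : γ₂ ∈ Γ) (m₃ : γ₃ ∈ Γ) (m₄ : γ₄ ∈ Γ) :
    randomMean Γ μ (fun U => centred μ U γ₁ * centred μ U γ₂ * centred μ U γ₃ * centred μ U γ₄) ≤
      (if γ₁ = γ₂ ∧ γ₃ = γ₄ then 1 else 0) + (if γ₁ = γ₃ ∧ γ₂ = γ₄ then 1 else 0) +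
        (if γ₁ = γ₄ ∧ γ₂ = γ₃ then 1 else 0) := by
  by_cases h : γ₁ = γ₂ ∧ γ₃ = γ₄ ∨ γ₁ = γ₃ ∧ γ₂ = γ₄ ∨ γ₁ = γ₄ ∧ γ₂ = γ₃
  · trans 1
    · rw [← randomMean_const (Γ := Γ) (μ := μ) 1]
      refine randomMean_mono h₀ h₁ fun U _ => (le_abs_self _).trans ?_
      simp only [abs_mul]
      have hle := abs_centred_le h₀ h₁ U (α := α)
      exact mul_le_one₀ (mul_le_one₀ (mul_le_one₀ (hle _) (abs_nonneg _) (hle _)) (abs_nonneg _)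
        (hle _)) (abs_nonneg _) (hle _)
    · rcases h with h | h | h <;> rw [if_pos h] <;> split_ifs <;> norm_num
  · have hisolated : (γ₂ ≠ γ₁ ∧ γ₃ ≠ γ₁ ∧ γ₄ ≠ γ₁) ∨ (γ₁ ≠ γ₂ ∧ γ₃ ≠ γ₂ ∧ γ₄ ≠ γ₂) ∨
        (γ₁ ≠ γ₃ ∧ γ₂ ≠ γ₃ ∧ γ₄ ≠ γ₃) ∨ (γ₁ ≠ γ₄ ∧ γ₂ ≠ γ₄ ∧ γ₃ ≠ γ₄) := by
      grind
    trans 0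
    · refine le_of_eq ?_
      rcases hisolated with ⟨h₂, h₃, h₄⟩ | ⟨h₂, h₃, h₄⟩ | ⟨h₂, h₃, h₄⟩ | ⟨h₂, h₃, h₄⟩
      · rw [← randomMean_four_centred_eq_zero m₁ h₂ h₃ h₄]; congr 1; ext U; ring
      · rw [← randomMean_four_centred_eq_zero m₂ h₂ h₃ h₄]; congr 1; ext U; ring
      · rw [← randomMean_four_centred_eq_zero m₃ h₂ h₃ h₄]; congr 1; ext U; ring
      · rw [← randomMean_four_centred_eq_zero m₄ h₂ h₃ h₄]; congr 1; ext U; ring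
    · positivity

/-- Only the quadruples that fall into two pairs of equal colours contribute. -/
lemma randomMean_sum_four_centred_le (h₀ : 0 ≤ μ) (h₁ : μ ≤ 1) {ι : Type*} [Fintype ι]
    {f₁ f₂ f₃ f₄ : ι → α} (m₁ : ∀ i, f₁ i ∈ Γ) (m₂ : ∀ i, f₂ i ∈ Γ) (m₃ : ∀ i, f₃ i ∈ Γ)
    (m₄ : ∀ i, f₄ i ∈ Γ) :
    randomMean Γ μ (fun U => ∑ i, centred μ U (f₁ i) * centred μ U (f₂ i) * centred μ U (f₃ i) *
      centred μ U (f₄ i)) ≤ #{i | f₁ i = f₂ i ∧ f₃ i = f₄ i} + #{i | f₁ i = f₃ i ∧ f₂ i = f₄ i} +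
        #{i | f₁ i = f₄ i ∧ f₂ i = f₃ i} := by
  rw [randomMean_sum, ← sum_boole, ← sum_boole, ← sum_boole, ← sum_add_distrib, ← sum_add_distrib]
  exact sum_le_sum fun i _ => randomMean_four_centred_le h₀ h₁ (m₁ i) (m₂ i) (m₃ i) (m₄ i)

end RandomSubset

section Moments

variable {A B : Type*} [Fintype A] [Fintype B]

lemma sum_pow_four (f : B → ℝ) :
    (∑ b, f b) ^ 4 = ∑ q : B × B × B × B, f q.1 * f q.2.1 * f q.2.2.1 * f q.2.2.2 := by
  simp only [Fintype.sum_prod_type, mul_assoc, ← mul_sum, ← sum_mul]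
  ring

/-- The number of four-cycles of the complete bipartite graph, each weighted by the product of the
values of `f` on its edges; degenerate cycles are included. -/
noncomputable def cycleSum (f : A → B → ℝ) : ℝ :=
  ∑ q : A × A × B × B, f q.1 q.2.2.1 * f q.2.1 q.2.2.1 * f q.1 q.2.2.2 * f q.2.1 q.2.2.2

lemma cycleSum_eq (f : A → B → ℝ) :
    cycleSum f = ∑ y, ∑ y', (∑ a, f a y * f a y') ^ 2 := by
  simp only [cycleSum, Fintype.sum_prod_type]
  calc ∑ a, ∑ a', ∑ y, ∑ y', f a y * f a' y * f a y' * f a' y'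
      = ∑ a, ∑ y, ∑ a', ∑ y', f a y * f a' y * f a y' * f a' y' :=
        sum_congr rfl fun a _ => sum_comm
    _ = ∑ y, ∑ a, ∑ a', ∑ y', f a y * f a' y * f a y' * f a' y' := sum_comm
    _ = ∑ y, ∑ a, ∑ y', ∑ a', f a y * f a' y * f a y' * f a' y' :=
        sum_congr rfl fun y _ => sum_congr rfl fun a _ => sum_comm
    _ = ∑ y, ∑ y', ∑ a, ∑ a', f a y * f a' y * f a y' * f a' y' :=
        sum_congr rfl fun y _ => sum_comm
    _ = ∑ y, ∑ y', (∑ a, f a y * f a y') ^ 2 := by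
        refine sum_congr rfl fun y _ => sum_congr rfl fun y' _ => ?_
        rw [sq, sum_mul_sum]
        exact sum_congr rfl fun a _ => sum_congr rfl fun a' _ => by ring

lemma cycleSum_nonneg (f : A → B → ℝ) : 0 ≤ cycleSum f := by
  rw [cycleSum_eq]
  exact sum_nonneg fun _ _ => sum_nonneg fun _ _ => sq_nonneg _

/-- Two applications of the Cauchy–Schwarz inequality, first over the rows and then over pairs of
columns. -/
lemma sum_sum_pow_four_le (f : A → B → ℝ) (X : Finset A) (Y : Finset B) :
    (∑ x ∈ X, ∑ y ∈ Y, f x y) ^ 4 ≤ (#X : ℝ) ^ 2 * (#Y : ℝ) ^ 2 * cycleSum f := by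
  have hrows : (∑ x ∈ X, ∑ y ∈ Y, f x y) ^ 2 ≤
      #X * ∑ y ∈ Y, ∑ y' ∈ Y, ∑ a, f a y * f a y' := by
    refine sq_sum_le_card_mul_sum_sq.trans (mul_le_mul_of_nonneg_left ?_ (Nat.cast_nonneg _))
    refine (sum_le_sum_of_subset_of_nonneg (subset_univ X) fun _ _ _ => sq_nonneg _).trans ?_
    simp only [sq, sum_mul_sum]
    rw [sum_comm]
    exact le_of_eq (sum_congr rfl fun y _ => sum_comm)
  have hpairs : (∑ y ∈ Y, ∑ y' ∈ Y, ∑ a, f a y * f a y') ^ 2 ≤ (#Y : ℝ) ^ 2 * cycleSum f := by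
    rw [← sum_product']
    refine sq_sum_le_card_mul_sum_sq.trans ?_
    rw [card_product, Nat.cast_mul, ← sq]
    refine mul_le_mul_of_nonneg_left ?_ (sq_nonneg _)
    rw [cycleSum_eq, ← sum_product', univ_product_univ]
    exact sum_le_sum_of_subset_of_nonneg (subset_univ _) fun _ _ _ => sq_nonneg _
  calc (∑ x ∈ X, ∑ y ∈ Y, f x y) ^ 4 = ((∑ x ∈ X, ∑ y ∈ Y, f x y) ^ 2) ^ 2 := by ring
    _ ≤ (#X * ∑ y ∈ Y, ∑ y' ∈ Y, ∑ a, f a y * f a y') ^ 2 :=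
        pow_le_pow_left₀ (sq_nonneg _) hrows 2
    _ = (#X : ℝ) ^ 2 * (∑ y ∈ Y, ∑ y' ∈ Y, ∑ a, f a y * f a y') ^ 2 := by ring
    _ ≤ (#X : ℝ) ^ 2 * ((#Y : ℝ) ^ 2 * cycleSum f) :=
        mul_le_mul_of_nonneg_left hpairs (sq_nonneg _)
    _ = (#X : ℝ) ^ 2 * (#Y : ℝ) ^ 2 * cycleSum f := by ring

lemma card_filter_le_of_injOn {p : A → Prop} [DecidablePred p] (g : A → B)
    (hg : Set.InjOn g {x | p x}) : #{x | p x} ≤ Fintype.card B := by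
  rw [← card_univ]
  exact card_le_card_of_injOn g (fun _ _ => mem_coe.2 (mem_univ _)) (by simpa using hg)

variable {α : Type*} [DecidableEq α] {Γ : Finset α} {μ : ℝ}

lemma randomMean_sum_centred_pow_four_le (h₀ : 0 ≤ μ) (h₁ : μ ≤ 1) {f : B → α} (hΓ : ∀ b, f b ∈ Γ)
    (hf : Function.Injective f) :
    randomMean Γ μ (fun U => (∑ b, centred μ U (f b)) ^ 4) ≤ 3 * (Fintype.card B : ℝ) ^ 2 := by
  classical
  simp only [sum_pow_four]
  have h₁₂ : #{q : B × B × B × B | f q.1 = f q.2.1 ∧ f q.2.2.1 = f q.2.2.2} ≤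
      Fintype.card (B × B) :=
    card_filter_le_of_injOn (fun q => (q.1, q.2.2.1)) (by simp only [hf.eq_iff]; grind [Set.InjOn])
  have h₁₃ : #{q : B × B × B × B | f q.1 = f q.2.2.1 ∧ f q.2.1 = f q.2.2.2} ≤
      Fintype.card (B × B) :=
    card_filter_le_of_injOn (fun q => (q.1, q.2.1)) (by simp only [hf.eq_iff]; grind [Set.InjOn])
  have h₁₄ : #{q : B × B × B × B | f q.1 = f q.2.2.2 ∧ f q.2.1 = f q.2.2.1} ≤
      Fintype.card (B × B) :=
    card_filter_le_of_injOn (fun q => (q.1, q.2.1)) (by simp only [hf.eq_iff]; grind [Set.InjOn])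
  refine (randomMean_sum_four_centred_le h₀ h₁ (fun _ => hΓ _) (fun _ => hΓ _) (fun _ => hΓ _)
    fun _ => hΓ _).trans ?_
  rw [Fintype.card_prod] at h₁₂ h₁₃ h₁₄
  norm_cast
  linarith

lemma randomMean_cycleSum_le (h₀ : 0 ≤ μ) (h₁ : μ ≤ 1) {c : A × B → α} (hΓ : ∀ p, c p ∈ Γ)
    (hc : IsProper c) :
    randomMean Γ μ (fun U => cycleSum fun a b => centred μ U (c (a, b))) ≤
      Fintype.card A * (Fintype.card B : ℝ) ^ 2 +
        2 * (Fintype.card A : ℝ) ^ 2 * Fintype.card B := by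
  have hrow : ∀ a b b', c (a, b) = c (a, b') → b = b' := fun a _ _ h => hc.row a h
  have hcol : ∀ a a' b, c (a, b) = c (a', b) → a = a' := fun _ _ b h => hc.col b h
  have h₁₂ : #{q : A × A × B × B | c (q.1, q.2.2.1) = c (q.2.1, q.2.2.1) ∧
      c (q.1, q.2.2.2) = c (q.2.1, q.2.2.2)} ≤ Fintype.card (A × B × B) :=
    card_filter_le_of_injOn (fun q => (q.1, q.2.2)) (by grind [Set.InjOn])
  have h₁₃ : #{q : A × A × B × B | c (q.1, q.2.2.1) = c (q.1, q.2.2.2) ∧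
      c (q.2.1, q.2.2.1) = c (q.2.1, q.2.2.2)} ≤ Fintype.card (A × A × B) :=
    card_filter_le_of_injOn (fun q => (q.1, q.2.1, q.2.2.1)) (by grind [Set.InjOn])
  have h₁₄ : #{q : A × A × B × B | c (q.1, q.2.2.1) = c (q.2.1, q.2.2.2) ∧
      c (q.2.1, q.2.2.1) = c (q.1, q.2.2.2)} ≤ Fintype.card (A × A × B) :=
    card_filter_le_of_injOn (fun q => (q.1, q.2.1, q.2.2.1)) (by grind [Set.InjOn])
  refine (randomMean_sum_four_centred_le h₀ h₁ (fun _ => hΓ _) (fun _ => hΓ _) (fun _ => hΓ _)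
    fun _ => hΓ _).trans ?_
  simp only [Fintype.card_prod] at h₁₂ h₁₃ h₁₄
  norm_cast
  linarith

end Moments

section Reserve

variable {A B α : Type*} [Fintype A] [Fintype B] [DecidableEq α] {c : A × B → α} {Γ U : Finset α}
  {μ : ℝ} {n : ℕ}

/-- A set `U` of colours that behaves, on the `n × n` array `c`, like a random set of density `μ`:
the number of cells coloured from `U` in each row, in each column and in each rectangle is close to
its expectation. -/
structure IsReserve (c : A × B → α) (μ : ℝ) (n : ℕ) (U : Finset α) : Prop where
  row : ∀ a, ((#{b | c (a, b) ∈ U} : ℝ) - μ * n) ^ 4 ≤ 18 * (n : ℝ) ^ 3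
  col : ∀ b, ((#{a | c (a, b) ∈ U} : ℝ) - μ * n) ^ 4 ≤ 18 * (n : ℝ) ^ 3
  rect : ∀ X Y, ((#{p ∈ X ×ˢ Y | c p ∈ U} : ℝ) - μ * #X * #Y) ^ 4 ≤ 18 * (n : ℝ) ^ 7

lemma sum_centred {κ : Type*} (s : Finset κ) (f : κ → α) :
    ∑ i ∈ s, centred μ U (f i) = #{i ∈ s | f i ∈ U} - μ * #s := by
  simp only [centred, sum_sub_distrib, sum_boole, sum_const, nsmul_eq_mul, mul_comm]

lemma isReserve_of_moments_le (hA : Fintype.card A = n) (hB : Fintype.card B = n)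
    (hrow : ∑ a, (∑ b, centred μ U (c (a, b))) ^ 4 ≤ 18 * (n : ℝ) ^ 3)
    (hcol : ∑ b, (∑ a, centred μ U (c (a, b))) ^ 4 ≤ 18 * (n : ℝ) ^ 3)
    (hcycle : cycleSum (fun a b => centred μ U (c (a, b))) ≤ 18 * (n : ℝ) ^ 3) :
    IsReserve c μ n U where
  row a := by
    rw [← hB, ← card_univ (α := B), ← sum_centred, card_univ, hB]
    exact (single_le_sum (f := fun a => (∑ b, centred μ U (c (a, b))) ^ 4)
      (fun _ _ => Even.pow_nonneg (by decide) _) (mem_univ a)).trans hrow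
  col b := by
    rw [← hA, ← card_univ (α := A), ← sum_centred, card_univ, hA]
    exact (single_le_sum (f := fun b => (∑ a, centred μ U (c (a, b))) ^ 4)
      (fun _ _ => Even.pow_nonneg (by decide) _) (mem_univ b)).trans hcol
  rect X Y := by
    rw [mul_assoc, ← Nat.cast_mul, ← card_product, ← sum_centred, sum_product]
    have hX : (#X : ℝ) ≤ n := by exact_mod_cast hA ▸ card_le_univ X
    have hY : (#Y : ℝ) ≤ n := by exact_mod_cast hB ▸ card_le_univ Y
    calc (∑ x ∈ X, ∑ y ∈ Y, centred μ U (c (x, y))) ^ 4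
        ≤ (#X : ℝ) ^ 2 * (#Y : ℝ) ^ 2 * cycleSum (fun a b => centred μ U (c (a, b))) :=
          sum_sum_pow_four_le _ X Y
      _ ≤ (n : ℝ) ^ 2 * (n : ℝ) ^ 2 * (18 * (n : ℝ) ^ 3) := by
          gcongr
          exact cycleSum_nonneg _
      _ = 18 * (n : ℝ) ^ 7 := by ring

theorem exists_isReserve (h₀ : 0 < μ) (h₁ : μ < 1) (hΓ : ∀ p, c p ∈ Γ) (hc : IsProper c)
    (hn : 0 < n) (hA : Fintype.card A = n) (hB : Fintype.card B = n) :
    ∃ U ⊆ Γ, (#U : ℝ) ≤ 2 * μ * #Γ ∧ IsReserve c μ n U := by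
  have : Nonempty A := Fintype.card_pos_iff.1 (hA ▸ hn)
  have : Nonempty B := Fintype.card_pos_iff.1 (hB ▸ hn)
  set rowSum : Finset α → ℝ := fun U => ∑ a, (∑ b, centred μ U (c (a, b))) ^ 4
  set colSum : Finset α → ℝ := fun U => ∑ b, (∑ a, centred μ U (c (a, b))) ^ 4
  set cycles : Finset α → ℝ := fun U => cycleSum fun a b => centred μ U (c (a, b))
  have hrow₀ : ∀ U, 0 ≤ rowSum U := fun U => sum_nonneg fun _ _ => Even.pow_nonneg (by decide) _
  have hcol₀ : ∀ U, 0 ≤ colSum U := fun U => sum_nonneg fun _ _ => Even.pow_nonneg (by decide) _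
  have hcycle₀ : ∀ U, 0 ≤ cycles U := fun U => cycleSum_nonneg _
  have hrow : randomMean Γ μ rowSum ≤ 3 * (n : ℝ) ^ 3 := by
    rw [randomMean_sum]
    refine (sum_le_card_nsmul _ _ _ fun a _ => randomMean_sum_centred_pow_four_le h₀.le h₁.le
      (fun _ => hΓ _) (hc.row a)).trans_eq ?_
    rw [card_univ, hA, hB, nsmul_eq_mul]
    ring
  have hcol : randomMean Γ μ colSum ≤ 3 * (n : ℝ) ^ 3 := by
    rw [randomMean_sum]
    refine (sum_le_card_nsmul _ _ _ fun b _ => randomMean_sum_centred_pow_four_le h₀.le h₁.le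
      (fun _ => hΓ _) (hc.col b)).trans_eq ?_
    rw [card_univ, hA, hB, nsmul_eq_mul]
    ring
  have hcycle : randomMean Γ μ cycles ≤ 3 * (n : ℝ) ^ 3 := by
    refine (randomMean_cycleSum_le h₀.le h₁.le hΓ hc).trans_eq ?_
    rw [hA, hB]
    ring
  obtain ⟨U, hU, hUcard, hle⟩ := exists_card_le_of_randomMean_le h₀ h₁
    ⟨c (Classical.arbitrary _), hΓ _⟩ (F := fun U => rowSum U + colSum U + cycles U)
    (fun U => add_nonneg (add_nonneg (hrow₀ U) (hcol₀ U)) (hcycle₀ U)) (C := 9 * (n : ℝ) ^ 3)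
    (by positivity) (by rw [randomMean_add, randomMean_add]; linarith)
  exact ⟨U, hU, hUcard, isReserve_of_moments_le hA hB (by linarith [hcol₀ U, hcycle₀ U])
    (by linarith [hrow₀ U, hcycle₀ U]) (by linarith [hrow₀ U, hcol₀ U])⟩

end Reserve

section Rare

variable {κ A B α : Type*} [Fintype κ] [Fintype A] [Fintype B] [DecidableEq α]

lemma card_filter_prod_eq_sum (P : A × B → Prop) [DecidablePred P] :
    #{p | P p} = ∑ a, #{b | P (a, b)} := by
  simp only [card_filter, Fintype.sum_prod_type]

lemma card_heavy_rows_mul_le {c : A × B → α} {R : Finset α} {K : ℕ}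
    (hR : ∀ γ ∈ R, #{p | c p = γ} ≤ K) (w : ℕ) :
    #{a | w < #{b | c (a, b) ∈ R}} * w ≤ #R * K :=
  calc #{a | w < #{b | c (a, b) ∈ R}} * w
      ≤ ∑ a with w < #{b | c (a, b) ∈ R}, #{b | c (a, b) ∈ R} := by
        rw [← smul_eq_mul]
        exact card_nsmul_le_sum _ _ _ fun a ha => (mem_filter.1 ha).2.le
    _ ≤ ∑ a, #{b | c (a, b) ∈ R} := sum_le_sum_of_subset (subset_univ _)
    _ = #{p | c p ∈ R} := (card_filter_prod_eq_sum (c · ∈ R)).symm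
    _ ≤ K * #R := by
        refine card_le_mul_card_image_of_maps_to (f := c) (fun p hp => (mem_filter.1 hp).2) K ?_
        exact fun γ hγ =>
          (card_le_card (filter_subset_filter _ (filter_subset _ _))).trans (hR γ hγ)
    _ = #R * K := mul_comm _ _

lemma card_frequent_colors_mul_le (c : κ → α) (K : ℕ) :
    #{γ ∈ univ.image c | K < #{p | c p = γ}} * K ≤ Fintype.card κ := by
  rw [mul_comm, ← card_univ]
  calc K * #{γ ∈ univ.image c | K < #{p | c p = γ}}
      ≤ #{p | c p ∈ ({γ ∈ univ.image c | K < #{p | c p = γ}} : Finset α)} :=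
        mul_card_image_le_card_of_maps_to (f := c) (fun p hp => (mem_filter.1 hp).2) K
          fun γ hγ => by
          rw [filter_filter]
          refine (mem_filter.1 hγ).2.le.trans (card_le_card fun p hp => ?_)
          have hpγ : c p = γ := (mem_filter.1 hp).2
          exact mem_filter.2 ⟨mem_univ _, hpγ ▸ hγ, hpγ⟩
    _ ≤ #(univ : Finset κ) := card_filter_le _ _

lemma exists_injOn_rare_colors (c : κ → α) (U : Finset α) (K : ℕ) :
    ∃ H : Finset κ, Set.InjOn c H ∧ (∀ h ∈ H, c h ∉ U) ∧ (∀ h ∈ H, #{p | c p = c h} ≤ K) ∧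
      #(univ.image c) * K ≤ #H * K + #U * K + Fintype.card κ := by
  set rare := {γ ∈ univ.image c | γ ∉ U ∧ #{p | c p = γ} ≤ K}
  set frequent := {γ ∈ univ.image c | K < #{p | c p = γ}}
  obtain ⟨H, -, hinj, hH⟩ := exists_subset_injOn_image_eq_of_surjOn (f := c) Set.univ rare (by
    intro γ hγ
    obtain ⟨p, -, rfl⟩ := mem_image.1 (mem_filter.1 hγ).1
    exact ⟨p, Set.mem_univ _, rfl⟩)
  have hrare : ∀ h ∈ H, c h ∉ U ∧ #{p | c p = c h} ≤ K := fun h hh =>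
    (mem_filter.1 (hH ▸ mem_image_of_mem c hh : c h ∈ rare)).2
  refine ⟨H, hinj, fun h hh => (hrare h hh).1, fun h hh => (hrare h hh).2, ?_⟩
  have hcover : univ.image c ⊆ rare ∪ (U ∪ frequent) := by
    intro γ hγ
    simp only [rare, frequent, mem_union, mem_filter, hγ, true_and, ← not_le]
    tauto
  calc #(univ.image c) * K ≤ (#rare + (#U + #frequent)) * K := by
        refine Nat.mul_le_mul_right K ((card_le_card hcover).trans ?_)
        exact (card_union_le _ _).trans (Nat.add_le_add_left (card_union_le _ _) _)
    _ = #H * K + #U * K + #frequent * K := by rw [← hH, card_image_of_injOn hinj]; ring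
    _ ≤ #H * K + #U * K + Fintype.card κ :=
        Nat.add_le_add_left (card_frequent_colors_mul_le c K) _

end Rare

section LinkedMatching

variable {A B α : Type*}

lemma exists_injOn_forall_mem_of_card_le {V W : Type*} [Nonempty W] (X : Finset V)
    (F : V → Finset W) (h : ∀ x ∈ X, #X ≤ #(F x)) :
    ∃ f : V → W, Set.InjOn f X ∧ ∀ x ∈ X, f x ∈ F x := by
  classical
  obtain ⟨f, hf, hfF⟩ : ∃ f : X → W, Function.Injective f ∧ ∀ x : X, f x ∈ F x := by
    refine (all_card_le_biUnion_card_iff_exists_injective (fun x : X => F x)).1 fun s => ?_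
    obtain rfl | ⟨x, hx⟩ := s.eq_empty_or_nonempty
    · simp
    · calc #s ≤ #X := by simpa using card_le_univ s
        _ ≤ #(F x) := h x x.2
        _ ≤ #(s.biUnion fun x => F x) :=
          card_le_card (subset_biUnion_of_mem (fun x : X => F x) hx)
  refine ⟨fun v => if hv : v ∈ X then f ⟨v, hv⟩ else Classical.arbitrary W, ?_, fun x hx => ?_⟩
  · intro x hx y hy hxy
    rw [mem_coe] at hx hy
    simp only [dif_pos hx, dif_pos hy] at hxy
    exact congrArg Subtype.val (hf hxy)
  · simp only [dif_pos hx]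
    exact hfF ⟨x, hx⟩

lemma sum_le_sum_filter_add {ι : Type*} (s : Finset ι) (f : ι → ℕ) (q : ℕ) :
    ∑ i ∈ s, f i ≤ ∑ i ∈ s with q ≤ f i, f i + #s * q := by
  rw [← sum_filter_add_sum_filter_not s (q ≤ f ·)]
  refine Nat.add_le_add_left ?_ _
  refine (sum_le_card_nsmul _ _ q fun i hi => (not_le.1 (mem_filter.1 hi).2).le).trans ?_
  exact Nat.mul_le_mul_right q (card_filter_le _ _)

lemma sum_le_card_filter_mul_add {ι : Type*} {s : Finset ι} {f : ι → ℕ} {m : ℕ}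
    (hf : ∀ i ∈ s, f i ≤ m) (q : ℕ) : ∑ i ∈ s, f i ≤ #{i ∈ s | q ≤ f i} * m + #s * q :=
  (sum_le_sum_filter_add s f q).trans <| Nat.add_le_add_right
    (sum_le_card_nsmul _ _ m fun i hi => hf i (mem_filter.1 hi).1) _

variable [Fintype A] [Fintype B] [DecidableEq A] [DecidableEq B] {H : Finset (A × B)} {n t q : ℕ}

lemma le_card_dense_columns (hn : 0 < n) (hA : Fintype.card A = n) (hB : Fintype.card B = n)
    (hH : 5 * t * n ≤ #H) :
    t ≤ #{b | 2 * t ≤ #{a | 2 * t ≤ #{b | (a, b) ∈ H} ∧ (a, b) ∈ H}} := by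
  have hrows : #H ≤ ∑ a with 2 * t ≤ #{b | (a, b) ∈ H}, #{b | (a, b) ∈ H} + n * (2 * t) :=
    calc #H = ∑ a, #{b | (a, b) ∈ H} := by rw [← card_filter_prod_eq_sum (· ∈ H)]; simp
      _ ≤ _ := hA ▸ sum_le_sum_filter_add _ _ _
  have hswap : ∑ a with 2 * t ≤ #{b | (a, b) ∈ H}, #{b | (a, b) ∈ H} =
      ∑ b, #{a | 2 * t ≤ #{b | (a, b) ∈ H} ∧ (a, b) ∈ H} := by
    simp only [← filter_filter, card_filter _ (filter _ _), card_filter _ (univ : Finset B)]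
    exact sum_comm
  have hcols := sum_le_card_filter_mul_add (s := univ) (m := n)
    (f := fun b => #{a | 2 * t ≤ #{b | (a, b) ∈ H} ∧ (a, b) ∈ H}) (fun b _ => hA ▸ card_le_univ _)
    (2 * t)
  rw [card_univ, hB] at hcols
  refine Nat.le_of_mul_le_mul_right ?_ hn
  linarith

lemma exists_dense_pair (hn : 0 < n) (hA : Fintype.card A = n) (hB : Fintype.card B = n)
    (hH : 5 * t * n ≤ #H) (hq : n * q ≤ t * t) :
    ∃ X : Finset A, ∃ Y : Finset B, #X = t ∧ #Y = t ∧ (∀ x ∈ X, 2 * t ≤ #{b | (x, b) ∈ H}) ∧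
      (∀ y ∈ Y, 2 * t ≤ #{a | (a, y) ∈ H}) ∧ ∀ x ∈ X, q ≤ #{y ∈ Y | (x, y) ∈ H} := by
  set A₁ : Finset A := {a | 2 * t ≤ #{b | (a, b) ∈ H}}
  obtain ⟨Y, hY, hYcard⟩ := exists_subset_card_eq (le_card_dense_columns hn hA hB hH)
  have hYH : ∀ y ∈ Y, 2 * t ≤ #{a ∈ A₁ | (a, y) ∈ H} := fun y hy => by
    rw [filter_filter]
    exact (mem_filter.1 (hY hy)).2
  have hXcard : t ≤ #{a ∈ A₁ | q ≤ #{y ∈ Y | (a, y) ∈ H}} := by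
    obtain rfl | ht := t.eq_zero_or_pos
    · exact Nat.zero_le _
    have hlow : t * (2 * t) ≤ ∑ y ∈ Y, #{a ∈ A₁ | (a, y) ∈ H} :=
      hYcard ▸ card_nsmul_le_sum _ _ _ (hYcard ▸ hYH)
    have hswap : ∑ y ∈ Y, #{a ∈ A₁ | (a, y) ∈ H} = ∑ a ∈ A₁, #{y ∈ Y | (a, y) ∈ H} := by
      simp only [card_filter]
      exact sum_comm
    have hup := sum_le_card_filter_mul_add (s := A₁) (f := fun a => #{y ∈ Y | (a, y) ∈ H}) (m := t)
      (fun a _ => hYcard ▸ card_filter_le _ _) q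
    have hA₁ : #A₁ * q ≤ n * q := Nat.mul_le_mul_right q (hA ▸ card_le_univ _)
    refine Nat.le_of_mul_le_mul_right ?_ ht
    linarith
  obtain ⟨X, hX, hXcard⟩ := exists_subset_card_eq hXcard
  refine ⟨X, Y, hXcard, hYcard, fun x hx => ?_, fun y hy => (hYH y hy).trans ?_,
    fun x hx => (mem_filter.1 (hX hx)).2⟩
  · exact (mem_filter.1 (mem_filter.1 (hX hx)).1).2
  · exact card_le_card (filter_subset_filter _ (subset_univ _))

omit [Fintype A] [Fintype B] in
lemma isRainbow_image_union_image {c : A × B → α} {X : Finset A} {Y : Finset B} {f : A → B}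
    {g : B → A} (hf : Set.InjOn f X) (hg : Set.InjOn g Y) (hfY : ∀ x ∈ X, f x ∉ Y)
    (hgX : ∀ y ∈ Y, g y ∉ X)
    (hc : Set.InjOn c (X.image (fun x => (x, f x)) ∪ Y.image fun y => (g y, y) : Finset (A × B))) :
    IsRainbow c (X.image (fun x => (x, f x)) ∪ Y.image fun y => (g y, y)) := by
  refine ⟨injOn_union_of_disjoint_image ?_ ?_ ?_, injOn_union_of_disjoint_image ?_ ?_ ?_, hc⟩
  · rw [coe_image]; exact .image_of_comp (Set.injOn_id _)
  · rw [coe_image]; exact .image_of_comp hg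
  · simpa [disjoint_left, image_image] using fun x hx y hy (e : g y = x) => hgX y hy (e ▸ hx)
  · rw [coe_image]; exact .image_of_comp hf
  · rw [coe_image]; exact .image_of_comp (Set.injOn_id _)
  · simpa [disjoint_left, image_image] using hfY

lemma exists_linked_matching {c : A × B → α} (hc : Set.InjOn c H) (hn : 0 < n)
    (hA : Fintype.card A = n) (hB : Fintype.card B = n) (hH : 5 * t * n ≤ #H)
    (hq : n * q ≤ t * t) :
    ∃ X : Finset A, ∃ Y : Finset B, ∃ M₀ ⊆ H, IsRainbow c M₀ ∧ #X = t ∧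
      X ⊆ M₀.image Prod.fst ∧ Y ⊆ M₀.image Prod.snd ∧ ∀ x ∈ X, q ≤ #{y ∈ Y | (x, y) ∈ H} := by
  obtain ⟨X, Y, hX, hY, hXH, hYH, hXY⟩ := exists_dense_pair hn hA hB hH hq
  have : Nonempty A := Fintype.card_pos_iff.1 (hA ▸ hn)
  have : Nonempty B := Fintype.card_pos_iff.1 (hB ▸ hn)
  obtain ⟨f, hf, hfH⟩ : ∃ f : A → B, Set.InjOn f X ∧
      ∀ x ∈ X, f x ∈ ({b | (x, b) ∈ H} : Finset B) \ Y :=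
    exists_injOn_forall_mem_of_card_le X _ fun x hx => by
      have := le_card_sdiff Y ({b | (x, b) ∈ H} : Finset B)
      have := hXH x hx
      omega
  obtain ⟨g, hg, hgH⟩ : ∃ g : B → A, Set.InjOn g Y ∧
      ∀ y ∈ Y, g y ∈ ({a | (a, y) ∈ H} : Finset A) \ X :=
    exists_injOn_forall_mem_of_card_le Y _ fun y hy => by
      have := le_card_sdiff X ({a | (a, y) ∈ H} : Finset A)
      have := hYH y hy
      omega
  simp only [mem_sdiff, mem_filter, mem_univ, true_and] at hfH hgH
  have hM₀ : X.image (fun x => (x, f x)) ∪ Y.image (fun y => (g y, y)) ⊆ H :=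
    union_subset (image_subset_iff.2 fun x hx => (hfH x hx).1)
      (image_subset_iff.2 fun y hy => (hgH y hy).1)
  refine ⟨X, Y, _, hM₀, isRainbow_image_union_image hf hg (fun x hx => (hfH x hx).2)
    (fun y hy => (hgH y hy).2) (hc.mono (coe_subset.2 hM₀)), hX, ?_, ?_, hXY⟩
  · exact fun x hx => mem_image.2 ⟨(x, f x), mem_union_left _ (mem_image_of_mem _ hx), rfl⟩
  · exact fun y hy => mem_image.2 ⟨(g y, y), mem_union_right _ (mem_image_of_mem _ hy), rfl⟩

end LinkedMatching

namespace IsAugmentation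

variable {A B α : Type*} [DecidableEq A] [DecidableEq B] [DecidableEq α] {c : A × B → α}
  {N N' P : Finset (A × B)} {D : Finset A} {E : Finset B} {U Z : Finset α}

lemma swap {N' : Finset (B × A)}
    (h : IsAugmentation (fun p : B × A => c p.swap) (N.image Prod.swap) E D Z N') :
    IsAugmentation c N D E Z (N'.image Prod.swap) where
  rainbow := by simpa only [Prod.swap_swap] using h.rainbow.image_swap
  card_eq := by
    simpa only [card_image_of_injective _ Prod.swap_injective] using h.card_eq
  rows := by
    simpa only [image_image, Function.comp_def, Prod.fst_swap, Prod.snd_swap] using h.cols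
  cols := by
    simpa only [image_image, Function.comp_def, Prod.fst_swap, Prod.snd_swap] using h.rows
  colors := by
    obtain ⟨u, hu, h⟩ := h.colors
    refine ⟨u, hu, ?_⟩
    simpa only [image_image, Function.comp_def, Prod.swap_swap] using h

lemma of_subset (h : IsAugmentation c N D E Z N') (hUZ : U ⊆ Z) : IsAugmentation c N D E U N' :=
  { h with colors := h.colors.imp fun _ hu => ⟨fun huU => hu.1 (hUZ huU), hu.2⟩ }

lemma disjoint_image_color (h : IsAugmentation c N D E Z N') (hN : Disjoint (N.image c) Z) :
    Disjoint (N'.image c) Z := by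
  obtain ⟨u, hu, hN'⟩ := h.colors
  exact (disjoint_insert_left.2 ⟨hu, hN⟩).mono_left hN'

lemma disjoint (h : IsAugmentation c N D E Z N') (hNP : IsRainbow c (N ∪ P)) (hdisj : Disjoint N P)
    (hD : Disjoint D (P.image Prod.fst)) : Disjoint N' P :=
  (disjoint_image_of_subset_union hNP.injOn_fst hdisj h.rows hD).of_image_finset

lemma union (h : IsAugmentation c N D E Z N') (hNP : IsRainbow c (N ∪ P)) (hdisj : Disjoint N P)
    (hD : Disjoint D (P.image Prod.fst)) (hE : Disjoint E (P.image Prod.snd))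
    (hP : P.image c ⊆ Z) : IsAugmentation c (N ∪ P) D E Z (N' ∪ P) := by
  obtain ⟨u, hu, hN'⟩ := h.colors
  refine ⟨h.rainbow.union (hNP.mono subset_union_right)
    (disjoint_image_of_subset_union hNP.injOn_fst hdisj h.rows hD)
    (disjoint_image_of_subset_union hNP.injOn_snd hdisj h.cols hE)
    (disjoint_image_of_subset_union hNP.injOn_color hdisj (D := {u}) ?_ ?_), ?_, ?_, ?_, u, hu, ?_⟩
  · rwa [union_comm, ← insert_eq]
  · exact disjoint_singleton_left.2 fun h' => hu (hP h')
  · rw [card_union_of_disjoint (h.disjoint hNP hdisj hD), card_union_of_disjoint hdisj, h.card_eq]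
    ring
  · rw [image_union, image_union, union_right_comm]
    exact union_subset_union_left h.rows
  · rw [image_union, image_union, union_right_comm]
    exact union_subset_union_left h.cols
  · rw [image_union, image_union, ← insert_union]
    exact union_subset_union_left hN'

/-- The cell `(x', y')` is replaced by `(x, y')`, which frees the row `x'` for the augmentation. -/
lemma link {x x' : A} {y' : B} (h : IsAugmentation c N {x'} E Z N') (hNP : IsRainbow c (N ∪ P))
    (hdisj : Disjoint N P) (hE : Disjoint E (P.image Prod.snd)) (hP : P.image c ⊆ Z)
    (hq : (x', y') ∈ P) (hx : x ∉ (N ∪ P).image Prod.fst) (hZ : c (x, y') ∈ Z)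
    (hc : c (x, y') ∉ (N ∪ P).image c) :
    IsRainbow c (insert (x, y') (N' ∪ P.erase (x', y'))) ∧
      #(insert (x, y') (N' ∪ P.erase (x', y'))) = #(N ∪ P) + 1 := by
  have hsub : P.erase (x', y') ⊆ P := erase_subset _ _
  have hPr : IsRainbow c P := hNP.mono subset_union_right
  have hM : IsAugmentation c (N ∪ P.erase (x', y')) {x'} E Z (N' ∪ P.erase (x', y')) :=
    h.union (hNP.mono (union_subset_union_right hsub)) (hdisj.mono_right hsub)
      (disjoint_singleton_left.2 (notMem_image_erase_of_injOn hPr.injOn_fst hq))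
      (hE.mono_right (image_subset_image hsub)) ((image_subset_image hsub).trans hP)
  have hx' : x ∉ (N' ∪ P.erase (x', y')).image Prod.fst := by
    have hne : x ≠ x' := by
      rintro rfl
      exact hx (mem_image.2 ⟨_, mem_union_right _ hq, rfl⟩)
    refine fun h' => (mem_union.1 (hM.rows h')).elim (fun h' => hx ?_) (by simpa using hne)
    exact image_subset_image (union_subset_union_right hsub) h'
  have hy' : y' ∉ (N' ∪ P.erase (x', y')).image Prod.snd := by
    rw [image_union, mem_union, not_or]
    exact ⟨fun h' => disjoint_left.1
      (disjoint_image_of_subset_union hNP.injOn_snd hdisj h.cols hE) h' (mem_image_of_mem _ hq),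
      notMem_image_erase_of_injOn hPr.injOn_snd hq⟩
  have hc' : c (x, y') ∉ (N' ∪ P.erase (x', y')).image c := by
    obtain ⟨u, hu, hM⟩ := hM.colors
    refine fun h' => (mem_insert.1 (hM h')).elim (fun e => hu (e ▸ hZ)) fun h' => hc ?_
    exact image_subset_image (union_subset_union_right hsub) h'
  refine ⟨hM.rainbow.insert hx' hy' hc', ?_⟩
  rw [card_insert_of_notMem fun h' => hx' (mem_image_of_mem _ h'), hM.card_eq,
    card_union_of_disjoint (hdisj.mono_right hsub), card_union_of_disjoint hdisj,
    ← card_erase_add_one hq]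
  ring

end IsAugmentation

section Rare

variable {A B α : Type*} [DecidableEq A] [DecidableEq B] [DecidableEq α] [Fintype A] [Fintype B]
  {c : A × B → α} {n K w : ℕ} {U R : Finset α} {N : Finset (A × B)}

lemma exists_isAugmentation_row_of_rare (hc : IsProper c) (hA : Fintype.card A = n)
    (hB : Fintype.card B = n) (hU : ∀ a, #{b | c (a, b) ∈ U} ≤ 2 * w)
    (hR : ∀ γ ∈ R, #{p | c p = γ} ≤ K) (hRcard : #R ≤ 2 * n) (hN : IsRainbow c N) {D : Finset A}
    (hD : Disjoint D (N.image Prod.fst)) (hDcard : n * (2 * K + 1) < #D * w) :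
    ∃ S : Finset B, n ≤ #S + #N + 4 * w ∧ ∀ y ∈ S, ∃ N', IsAugmentation c N D {y} (U ∪ R) N' := by
  set D' : Finset A := {a ∈ D | #{b | c (a, b) ∈ R} ≤ w}
  have hD' : D' ⊆ D := filter_subset _ _
  have hheavy : #(D \ D') * w ≤ 2 * n * K := by
    refine le_trans (Nat.mul_le_mul_right _ (card_le_card fun a ha => ?_))
      ((card_heavy_rows_mul_le hR w).trans (Nat.mul_le_mul_right _ hRcard))
    simp only [D', mem_sdiff, mem_filter, not_and, not_le, mem_univ, true_and] at ha ⊢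
    exact ha.2 ha.1
  have hcard : #N < #D' * w := by
    have hNn := hN.card_le
    rw [← card_sdiff_add_card_eq_card hD'] at hDcard
    linarith
  have hZ : ∀ a ∈ D', #{b | c (a, b) ∈ U ∪ R} ≤ 3 * w := by
    intro a ha
    have hR' : #{b | c (a, b) ∈ R} ≤ w := (mem_filter.1 ha).2
    have hUR := card_union_le ({b | c (a, b) ∈ U} : Finset B) {b | c (a, b) ∈ R}
    simp only [mem_union, filter_or]
    linarith [hU a]
  obtain ⟨S, hS, haug⟩ :=
    exists_isAugmentation_of_card_lt hc hN (hD.mono_left hD') hZ hcard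
  refine ⟨S, by omega, fun y hy => ?_⟩
  obtain ⟨N', hN'⟩ := haug y hy
  exact ⟨N', { hN' with rows := hN'.rows.trans (union_subset_union_right hD') }⟩

lemma exists_isAugmentation_col_of_rare (hc : IsProper c) (hA : Fintype.card A = n)
    (hB : Fintype.card B = n) (hU : ∀ b, #{a | c (a, b) ∈ U} ≤ 2 * w)
    (hR : ∀ γ ∈ R, #{p | c p = γ} ≤ K) (hRcard : #R ≤ 2 * n) (hN : IsRainbow c N) {E : Finset B}
    (hE : Disjoint E (N.image Prod.snd)) (hEcard : n * (2 * K + 1) < #E * w) :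
    ∃ S : Finset A, n ≤ #S + #N + 4 * w ∧ ∀ x ∈ S, ∃ N', IsAugmentation c N {x} E (U ∪ R) N' := by
  have hR' : ∀ γ ∈ R, #{p : B × A | c p.swap = γ} ≤ K := by
    refine fun γ hγ => (card_le_card_of_injOn Prod.swap (fun p hp => ?_)
      Prod.swap_injective.injOn).trans (hR γ hγ)
    simpa using hp
  obtain ⟨S, hS, haug⟩ := exists_isAugmentation_row_of_rare hc.swap hB hA hU hR' hRcard
    hN.image_swap (by simpa only [image_image, Function.comp_def, Prod.fst_swap] using hE) hEcard
  rw [card_image_of_injective _ Prod.swap_injective] at hS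
  refine ⟨S, hS, fun x hx => ?_⟩
  obtain ⟨N', hN'⟩ := haug x hx
  exact ⟨_, hN'.swap⟩

end Rare

section LinkedSystem

lemma exists_mem_of_card_lt_add {κ ι ι' : Type*} [DecidableEq ι] [DecidableEq ι']
    {π : κ → ι} {ρ : κ → ι'} {M P : Finset κ} {X : Finset ι} {S : Finset ι'} (hP : P ⊆ M)
    (hX : X ⊆ M.image π) (hS : S ⊆ P.image ρ) (hcard : #M < #X + #S) :
    ∃ p ∈ P, π p ∈ X ∧ ρ p ∈ S := by
  classical
  by_contra! hcon
  have hXM : X ⊆ (M \ {p ∈ P | ρ p ∈ S}).image π := by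
    intro x hx
    obtain ⟨p, hp, rfl⟩ := mem_image.1 (hX hx)
    refine mem_image_of_mem _ (mem_sdiff.2 ⟨hp, fun hp' => ?_⟩)
    exact hcon p (mem_filter.1 hp').1 hx (mem_filter.1 hp').2
  have hSP : S ⊆ ({p ∈ P | ρ p ∈ S} : Finset κ).image ρ := by
    intro y hy
    obtain ⟨p, hp, rfl⟩ := mem_image.1 (hS hy)
    exact mem_image_of_mem _ (mem_filter.2 ⟨hp, hy⟩)
  have := card_sdiff_add_card_eq_card ((filter_subset (ρ · ∈ S) P).trans hP)
  have := (card_le_card hXM).trans card_image_le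
  have := (card_le_card hSP).trans card_image_le
  omega

variable {A B α : Type*} [DecidableEq A] [DecidableEq B] [DecidableEq α]
  {c : A × B → α} {n K w : ℕ} {U : Finset α} {H M₀ : Finset (A × B)} {X : Finset A} {Y : Finset B}
  {a : A}

lemma card_saturated_rows_mul_le (hH : Set.InjOn c H) (V : Finset α) (X : Finset A)
    (Y : Finset B) (w : ℕ) :
    #{x ∈ X | w < #{y ∈ Y | (x, y) ∈ H ∧ c (x, y) ∈ V}} * w ≤ #V :=
  calc #{x ∈ X | w < #{y ∈ Y | (x, y) ∈ H ∧ c (x, y) ∈ V}} * w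
      ≤ ∑ x ∈ X with w < #{y ∈ Y | (x, y) ∈ H ∧ c (x, y) ∈ V},
          #{y ∈ Y | (x, y) ∈ H ∧ c (x, y) ∈ V} := by
        rw [← smul_eq_mul]
        exact card_nsmul_le_sum _ _ _ fun x hx => (mem_filter.1 hx).2.le
    _ ≤ ∑ x ∈ X, #{y ∈ Y | (x, y) ∈ H ∧ c (x, y) ∈ V} :=
        sum_le_sum_of_subset (filter_subset _ _)
    _ = #{p ∈ X ×ˢ Y | p ∈ H ∧ c p ∈ V} := by simp only [card_filter, sum_product]
    _ ≤ #V := card_le_card_of_injOn c (fun p hp => (mem_filter.1 hp).2.2)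
        (hH.mono fun p hp => (mem_filter.1 (mem_coe.1 hp)).2.1)

lemma card_filter_mem_le_of_subset_insert (hc : Function.Injective fun b => c (a, b)) {u : α}
    {V V' : Finset α} (hV : V ⊆ insert u V') (H : Finset (A × B)) (Y : Finset B) :
    #{y ∈ Y | (a, y) ∈ H ∧ c (a, y) ∈ V} ≤ #{y ∈ Y | (a, y) ∈ H ∧ c (a, y) ∈ V'} + 1 := by
  have hcover : ({y ∈ Y | (a, y) ∈ H ∧ c (a, y) ∈ V} : Finset B) ⊆
      ({y ∈ Y | (a, y) ∈ H ∧ c (a, y) ∈ V'} : Finset B) ∪ ({y ∈ Y | c (a, y) = u} : Finset B) := by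
    intro y hy
    obtain ⟨hyY, hyH, hyV⟩ := mem_filter.1 hy
    have := mem_insert.1 (hV hyV)
    simp only [mem_union, mem_filter]
    tauto
  refine (card_le_card hcover).trans ((card_union_le _ _).trans (Nat.add_le_add_left ?_ _))
  refine card_le_one.2 fun y hy y' hy' => hc ?_
  exact (mem_filter.1 hy).2.trans (mem_filter.1 hy').2.symm

/-- The matching `M'` is a variant of the rainbow matching `M` of the same size, in which the row
`x` has been freed without using a new column, and which has at most one new colour, which lies
outside `Z`. -/
structure IsRowShift (c : A × B → α) (M : Finset (A × B)) (x : A) (Z : Finset α)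
    (M' : Finset (A × B)) : Prop where
  rainbow : IsRainbow c M'
  card_eq : #M' = #M
  row : x ∉ M'.image Prod.fst
  cols : M'.image Prod.snd ⊆ M.image Prod.snd
  colors : ∃ u ∉ Z, M'.image c ⊆ insert u (M.image c)

lemma IsAugmentation.isRowShift {N P N' : Finset (A × B)} {D : Finset A} {Z : Finset α}
    {p : A × B} (h : IsAugmentation c N D {p.2} Z N') (hNP : IsRainbow c (N ∪ P))
    (hdisj : Disjoint N P) (hD : Disjoint D (P.image Prod.fst)) (hP : P.image c ⊆ Z) (hp : p ∈ P) :
    IsRowShift c (N ∪ P) p.1 Z (N' ∪ P.erase p) := by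
  have hsub : P.erase p ⊆ P := erase_subset _ _
  have hPr : IsRainbow c P := hNP.mono subset_union_right
  have hM : IsAugmentation c (N ∪ P.erase p) D {p.2} Z (N' ∪ P.erase p) :=
    h.union (hNP.mono (union_subset_union_right hsub)) (hdisj.mono_right hsub)
      (hD.mono_right (image_subset_image hsub))
      (disjoint_singleton_left.2 (notMem_image_erase_of_injOn hPr.injOn_snd hp))
      ((image_subset_image hsub).trans hP)
  refine ⟨hM.rainbow, ?_, ?_, ?_, ?_⟩
  · rw [hM.card_eq, card_union_of_disjoint (hdisj.mono_right hsub), card_union_of_disjoint hdisj,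
      ← card_erase_add_one hp, add_assoc]
  · rw [image_union, mem_union, not_or]
    exact ⟨fun h' => disjoint_left.1
      (disjoint_image_of_subset_union hNP.injOn_fst hdisj h.rows hD) h' (mem_image_of_mem _ hp),
      notMem_image_erase_of_injOn hPr.injOn_fst hp⟩
  · refine hM.cols.trans (union_subset (image_subset_image (union_subset_union_right hsub)) ?_)
    exact singleton_subset_iff.2 (mem_image_of_mem _ (mem_union_right _ hp))
  · obtain ⟨u, hu, hM⟩ := hM.colors
    exact ⟨u, hu, hM.trans (insert_subset_insert _
      (image_subset_image (union_subset_union_right hsub)))⟩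

variable [Fintype A] [Fintype B]

/-- A rainbow matching `M₀` inside a set `H` of cells of distinct colours, each occurring at most
`K` times and outside `U`, such that `M₀` covers the rows `X` and the columns `Y`, and each row of
`X` has many cells of `H` in the columns of `Y`. These cells will link the two halves of an
augmentation. The parameter `w` is half of the bound on the number of cells of a line with a colour
in `U`. -/
structure IsLinkedSystem (c : A × B → α) (n K w : ℕ) (U : Finset α) (H M₀ : Finset (A × B))
    (X : Finset A) (Y : Finset B) : Prop where
  cardA : Fintype.card A = n
  cardB : Fintype.card B = n
  proper : IsProper c
  rowU : ∀ a, #{b | c (a, b) ∈ U} ≤ 2 * w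
  colU : ∀ b, #{a | c (a, b) ∈ U} ≤ 2 * w
  w_pos : 0 < w
  injOn : Set.InjOn c H
  notMem : ∀ h ∈ H, c h ∉ U
  rare : ∀ h ∈ H, #{p | c p = c h} ≤ K
  subset : M₀ ⊆ H
  rainbow : IsRainbow c M₀
  rows : X ⊆ M₀.image Prod.fst
  cols : Y ⊆ M₀.image Prod.snd
  linked : ∀ x ∈ X, 20 * w ≤ #{y ∈ Y | (x, y) ∈ H}
  size : n + 14 * w * w < #X * w

namespace IsLinkedSystem

variable {M N P : Finset (A × B)} {D : Finset A} {E : Finset B} {x : A}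

lemma rare_of_mem_image (h : IsLinkedSystem c n K w U H M₀ X Y) :
    ∀ γ ∈ M₀.image c, #{p | c p = γ} ≤ K := by
  intro γ hγ
  obtain ⟨p, hp, rfl⟩ := mem_image.1 hγ
  exact h.rare p (h.subset hp)

lemma card_image_color_le (h : IsLinkedSystem c n K w U H M₀ X Y) : #(M₀.image c) ≤ n :=
  card_image_le.trans (h.cardA ▸ h.rainbow.card_le)

lemma exists_isAugmentation_row (h : IsLinkedSystem c n K w U H M₀ X Y)
    (hNP : IsRainbow c (N ∪ P)) (hdisj : Disjoint N P) (hP : P ⊆ M₀)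
    (hD : Disjoint D ((N ∪ P).image Prod.fst)) (hDcard : n * (2 * K + 1) < #D * w) :
    (∃ E M', IsAugmentation c (N ∪ P) D E U M' ∧ P ⊆ M') ∨
      ∃ S ⊆ P.image Prod.snd, n ≤ #S + #N + 4 * w ∧
        ∀ y ∈ S, ∃ N', IsAugmentation c N D {y} (U ∪ M₀.image c) N' := by
  obtain ⟨S, hS, haug⟩ := exists_isAugmentation_row_of_rare h.proper h.cardA h.cardB h.rowU
    h.rare_of_mem_image (by linarith [h.card_image_color_le]) (hNP.mono subset_union_left)
    (hD.mono_right (image_subset_image subset_union_left)) hDcard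
  by_cases hSP : S ⊆ P.image Prod.snd
  · exact .inr ⟨S, hSP, hS, haug⟩
  · obtain ⟨y, hyS, hyP⟩ := not_subset.1 hSP
    obtain ⟨N', hN'⟩ := haug y hyS
    have hM' := hN'.union hNP hdisj (hD.mono_right (image_subset_image subset_union_right))
      (disjoint_singleton_left.2 hyP) ((image_subset_image hP).trans subset_union_right)
    exact .inl ⟨_, _, hM'.of_subset subset_union_left, subset_union_right⟩

lemma exists_isAugmentation_col (h : IsLinkedSystem c n K w U H M₀ X Y) (x : A)
    (hNP : IsRainbow c (N ∪ P)) (hdisj : Disjoint N P) (hP : P ⊆ M₀)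
    (hE : Disjoint E ((N ∪ P).image Prod.snd)) (hEcard : n * (2 * K + 1) < #E * w) :
    (∃ D M', IsAugmentation c (N ∪ P) D E U M' ∧ P ⊆ M') ∨
      ∃ S ⊆ P.image Prod.fst, n ≤ #S + #N + 4 * w ∧ ∀ x' ∈ S, ∃ N',
        IsAugmentation c N {x'} E (U ∪ (M₀ ∪ {p ∈ H | p.1 = x}).image c) N' := by
  have hR : ∀ γ ∈ (M₀ ∪ {p ∈ H | p.1 = x}).image c, #{p | c p = γ} ≤ K := by
    intro γ hγ
    obtain ⟨p, hp, rfl⟩ := mem_image.1 hγ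
    exact h.rare p (union_subset h.subset (filter_subset _ _) hp)
  have hRcard : #((M₀ ∪ {p ∈ H | p.1 = x}).image c) ≤ 2 * n := by
    have hrow : #{p ∈ H | p.1 = x} ≤ n := by
      rw [← h.cardB, ← card_univ]
      refine card_le_card_of_injOn Prod.snd (fun _ _ => mem_univ _) fun p hp q hq hpq => ?_
      exact Prod.ext ((mem_filter.1 hp).2.trans (mem_filter.1 hq).2.symm) hpq
    have hM₀ : #M₀ ≤ n := h.cardA ▸ h.rainbow.card_le
    have hle := (card_image_le (f := c)).trans (card_union_le M₀ {p ∈ H | p.1 = x})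
    linarith
  obtain ⟨S, hS, haug⟩ := exists_isAugmentation_col_of_rare h.proper h.cardA h.cardB h.colU
    hR hRcard (hNP.mono subset_union_left)
    (hE.mono_right (image_subset_image subset_union_left)) hEcard
  by_cases hSP : S ⊆ P.image Prod.fst
  · exact .inr ⟨S, hSP, hS, haug⟩
  · obtain ⟨x', hxS, hxP⟩ := not_subset.1 hSP
    obtain ⟨N', hN'⟩ := haug x' hxS
    have hM' := hN'.union hNP hdisj (disjoint_singleton_left.2 hxP)
      (hE.mono_right (image_subset_image subset_union_right))
      ((image_subset_image (hP.trans subset_union_left)).trans subset_union_right)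
    exact .inl ⟨_, _, hM'.of_subset subset_union_left, subset_union_right⟩

lemma exists_larger_of_free_row (h : IsLinkedSystem c n K w U H M₀ X Y)
    (hNP : IsRainbow c (N ∪ P)) (hdisj : Disjoint N P) (hU : Disjoint ((N ∪ P).image c) U)
    (hP : P ⊆ M₀) (hPcard : #M₀ ≤ #P + 11 * w) (hE : Disjoint E ((N ∪ P).image Prod.snd))
    (hEcard : n * (2 * K + 1) < #E * w) (hx : x ∈ X) (hxNP : x ∉ (N ∪ P).image Prod.fst)
    (hsat : #{y ∈ Y | (x, y) ∈ H ∧ c (x, y) ∈ (N ∪ P).image c} ≤ 2 * w) :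
    ∃ M', IsRainbow c M' ∧ Disjoint (M'.image c) U ∧ #M' = #(N ∪ P) + 1 ∧ #(P \ M') ≤ 1 := by
  obtain ⟨D, M', hM', hPM'⟩ | ⟨S, hSP, hS, haug⟩ :=
    h.exists_isAugmentation_col x hNP hdisj hP hE hEcard
  · refine ⟨M', hM'.rainbow, hM'.disjoint_image_color hU, hM'.card_eq, ?_⟩
    simp [sdiff_eq_empty_iff_subset.2 hPM']
  set Y' : Finset B := {y ∈ Y | (x, y) ∈ H ∧ c (x, y) ∉ (N ∪ P).image c}
  have hY' : 18 * w ≤ #Y' := by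
    have hsplit : #{y ∈ Y | (x, y) ∈ H ∧ c (x, y) ∈ (N ∪ P).image c} + #Y' =
        #{y ∈ Y | (x, y) ∈ H} := by
      simpa only [filter_filter] using card_filter_add_card_filter_not
        (s := {y ∈ Y | (x, y) ∈ H}) (fun y => c (x, y) ∈ (N ∪ P).image c)
    have := h.linked x hx
    omega
  obtain ⟨⟨x', y'⟩, hq, hy', hx'⟩ : ∃ q ∈ P, q.2 ∈ Y' ∧ q.1 ∈ S := by
    refine exists_mem_of_card_lt_add hP ((filter_subset _ _).trans h.cols) hSP ?_
    have hn := hNP.card_le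
    rw [h.cardA, card_union_of_disjoint hdisj] at hn
    have := h.w_pos
    omega
  obtain ⟨-, hH, hfresh⟩ := mem_filter.1 hy'
  obtain ⟨N', hN'⟩ := haug x' hx'
  have hlink := hN'.link hNP hdisj (hE.mono_right (image_subset_image subset_union_right))
    ((image_subset_image (hP.trans subset_union_left)).trans subset_union_right) hq hxNP
    (mem_union_right _ (mem_image_of_mem c (mem_union_right _ (mem_filter.2 ⟨hH, rfl⟩)))) hfresh
  have hN'U : Disjoint (N'.image c) U := (hN'.of_subset subset_union_left).disjoint_image_color
    (hU.mono_left (image_subset_image subset_union_left))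
  have hPU : Disjoint ((P.erase (x', y')).image c) U :=
    hU.mono_left (image_subset_image ((erase_subset _ _).trans subset_union_right))
  refine ⟨_, hlink.1, ?_, hlink.2, ?_⟩
  · rw [image_insert, image_union]
    exact disjoint_insert_left.2 ⟨h.notMem _ hH, disjoint_union_left.2 ⟨hN'U, hPU⟩⟩
  · refine (card_le_card (t := {(x', y')}) fun p hp => ?_).trans (card_singleton _).le
    simp only [mem_sdiff, mem_insert, mem_union, mem_erase, mem_singleton] at hp ⊢
    tauto

lemma exists_isRowShift (h : IsLinkedSystem c n K w U H M₀ X Y) (hM : IsRainbow c M)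
    (hlost : #(M₀ \ M) ≤ 10 * w) {S : Finset B} (hSM : S ⊆ (M ∩ M₀).image Prod.snd)
    (hS : n ≤ #S + #(M \ M₀) + 4 * w)
    (haug : ∀ y ∈ S, ∃ N', IsAugmentation c (M \ M₀) (M.image Prod.fst)ᶜ {y} (U ∪ M₀.image c) N') :
    ∃ p ∈ M ∩ M₀, ∃ N', p.1 ∈ X ∧ Disjoint N' ((M ∩ M₀).erase p) ∧
      IsRowShift c M p.1 U (N' ∪ (M ∩ M₀).erase p) ∧
      #{y ∈ Y | (p.1, y) ∈ H ∧ c (p.1, y) ∈ M.image c} ≤ w := by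
  set X₁ : Finset A := {x ∈ X | w < #{y ∈ Y | (x, y) ∈ H ∧ c (x, y) ∈ M.image c}}
  have hX₁ : #X₁ * w ≤ n := (card_saturated_rows_mul_le h.injOn (M.image c) X Y w).trans
    (card_image_le.trans (h.cardA ▸ hM.card_le))
  have hX : 14 * w < #(X \ X₁) := by
    refine lt_of_mul_lt_mul_right (a := w) ?_ (Nat.zero_le _)
    have hsize := h.size
    have hX₁X : X₁ ⊆ X := filter_subset _ _
    rw [← card_sdiff_add_card_eq_card hX₁X, add_mul] at hsize
    omega
  obtain ⟨p, hp, hpX, hpS⟩ : ∃ p ∈ M ∩ M₀, p.1 ∈ X \ X₁ ∧ p.2 ∈ S := by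
    refine exists_mem_of_card_lt_add inter_subset_right (sdiff_subset.trans h.rows) hSM ?_
    have hM₀ := card_sdiff_add_card_inter M₀ M
    have hMsplit := card_sdiff_add_card_inter M M₀
    have hMn := h.cardA ▸ hM.card_le
    rw [inter_comm] at hM₀
    omega
  have hMeq : M \ M₀ ∪ M ∩ M₀ = M := sdiff_union_inter M M₀
  have hM' : IsRainbow c (M \ M₀ ∪ M ∩ M₀) := hMeq.symm ▸ hM
  have hdisj : Disjoint (M \ M₀) (M ∩ M₀) := disjoint_sdiff_inter M M₀
  have hD : Disjoint (M.image Prod.fst)ᶜ ((M ∩ M₀).image Prod.fst) :=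
    disjoint_compl_left.mono_right (image_subset_image inter_subset_left)
  obtain ⟨N', hN'⟩ := haug p.2 hpS
  obtain ⟨hpX, hpX₁⟩ := mem_sdiff.1 hpX
  have hshift := hN'.isRowShift hM' hdisj hD
    ((image_subset_image inter_subset_right).trans subset_union_right) hp
  rw [hMeq] at hshift
  refine ⟨p, hp, N', hpX, ?_, { hshift with colors := ?_ }, ?_⟩
  · exact hN'.disjoint (hM'.mono (union_subset_union_right (erase_subset _ _)))
      (hdisj.mono_right (erase_subset _ _))
      (hD.mono_right (image_subset_image (erase_subset _ _)))
  · exact hshift.colors.imp fun u hu => ⟨fun h' => hu.1 (mem_union_left _ h'), hu.2⟩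
  · simpa [X₁, hpX] using hpX₁

theorem exists_larger (h : IsLinkedSystem c n K w U H M₀ X Y) (hM : IsRainbow c M)
    (hMU : Disjoint (M.image c) U) (hlost : #(M₀ \ M) ≤ 10 * w)
    (hlarge : n * (2 * K + 1) < (n - #M) * w) :
    ∃ M', IsRainbow c M' ∧ Disjoint (M'.image c) U ∧ #M' = #M + 1 ∧
      #(M₀ \ M') ≤ #(M₀ \ M) + 2 := by
  have hMeq : M \ M₀ ∪ M ∩ M₀ = M := sdiff_union_inter M M₀
  have hD : #(M.image Prod.fst)ᶜ = n - #M := by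
    rw [card_compl, card_image_of_injOn hM.injOn_fst, h.cardA]
  have hE : #(M.image Prod.snd)ᶜ = n - #M := by
    rw [card_compl, card_image_of_injOn hM.injOn_snd, h.cardB]
  have hrow := h.exists_isAugmentation_row (hMeq.symm ▸ hM) (disjoint_sdiff_inter M M₀)
    inter_subset_right (hMeq.symm ▸ disjoint_compl_left) (hD.symm ▸ hlarge)
  rw [hMeq] at hrow
  obtain ⟨E, M', hM', hPM'⟩ | ⟨S, hSM, hS, haug⟩ := hrow
  · refine ⟨M', hM'.rainbow, hM'.disjoint_image_color hMU, hM'.card_eq, ?_⟩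
    refine (card_le_card fun p hp => ?_).trans (Nat.le_add_right _ 2)
    obtain ⟨hp₀, hp⟩ := mem_sdiff.1 hp
    exact mem_sdiff.2 ⟨hp₀, fun hpM => hp (hPM' (mem_inter.2 ⟨hpM, hp₀⟩))⟩
  obtain ⟨p, hp, N', hpX, hdisj, hshift, hsat⟩ := h.exists_isRowShift hM hlost hSM hS haug
  set P := (M ∩ M₀).erase p
  have hPM₀ : P ⊆ M₀ := (erase_subset _ _).trans inter_subset_right
  have hP : #(M₀ \ P) + #P = #M₀ := card_sdiff_add_card_eq_card hPM₀
  have hPM : #(M₀ \ M) + (#P + 1) = #M₀ := by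
    rw [card_erase_add_one hp, inter_comm]
    exact card_sdiff_add_card_inter M₀ M
  have hw := h.w_pos
  obtain ⟨u, hu, hcol⟩ := hshift.colors
  have hsat' : #{y ∈ Y | (p.1, y) ∈ H ∧ c (p.1, y) ∈ (N' ∪ P).image c} ≤ 2 * w :=
    (card_filter_mem_le_of_subset_insert (h.proper.row p.1) hcol H Y).trans (by omega)
  obtain ⟨M', hM', hM'U, hM'card, hPM'⟩ := h.exists_larger_of_free_row hshift.rainbow hdisj
    ((disjoint_insert_left.2 ⟨hu, hMU⟩).mono_left hcol) hPM₀ (by omega)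
    (disjoint_compl_left.mono_right hshift.cols) (hE.symm ▸ hlarge) hpX hshift.row hsat'
  refine ⟨M', hM', hM'U, hM'card.trans (by rw [hshift.card_eq]), ?_⟩
  have hcover : M₀ \ M' ⊆ (M₀ \ P) ∪ (P \ M') := sdiff_triangle _ _ _
  have := (card_le_card hcover).trans (card_union_le _ _)
  omega

lemma exists_initial (h : IsLinkedSystem c n K w U H M₀ X Y) (hw : n * (2 * K + 1) < 5 * w * w) :
    ∃ M, M₀ ⊆ M ∧ IsRainbow c M ∧ Disjoint (M.image c) U ∧ n ≤ #M + 5 * w := by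
  have hM₀U : Disjoint (M₀.image c) U := disjoint_left.2 fun γ hγ => by
    obtain ⟨p, hp, rfl⟩ := mem_image.1 hγ
    exact h.notMem p (h.subset hp)
  obtain ⟨M, ⟨hM₀, hM, hMU⟩, hmax⟩ := Set.exists_max_image
    {M : Finset (A × B) | M₀ ⊆ M ∧ IsRainbow c M ∧ Disjoint (M.image c) U} card
    (Set.toFinite _) ⟨M₀, subset_rfl, h.rainbow, hM₀U⟩
  refine ⟨M, hM₀, hM, hMU, ?_⟩
  by_contra! hcard
  have hMeq : M \ M₀ ∪ M₀ = M := sdiff_union_of_subset hM₀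
  have hD : #(M.image Prod.fst)ᶜ = n - #M := by
    rw [card_compl, card_image_of_injOn hM.injOn_fst, h.cardA]
  have hDcard : n * (2 * K + 1) < #(M.image Prod.fst)ᶜ * w :=
    hw.trans_le (Nat.mul_le_mul_right w (by omega))
  have hrow := h.exists_isAugmentation_row (hMeq.symm ▸ hM) sdiff_disjoint subset_rfl
    (hMeq.symm ▸ disjoint_compl_left) hDcard
  rw [hMeq] at hrow
  obtain ⟨E, M', hM', hM₀M'⟩ | ⟨S, hSM, hS, -⟩ := hrow
  · have := hmax M' ⟨hM₀M', hM'.rainbow, hM'.disjoint_image_color hMU⟩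
    have := hM'.card_eq
    omega
  · have := (card_le_card hSM).trans card_image_le
    have := card_sdiff_add_card_eq_card hM₀
    omega

/-- Each enlargement loses at most two cells of `M₀`, and at most `5 * w` enlargements are needed,
so the matching keeps all but `10 * w` cells of `M₀` on the way. -/
theorem exists_almost_perfect (h : IsLinkedSystem c n K w U H M₀ X Y)
    (hw : n * (2 * K + 1) < 5 * w * w) :
    ∃ M, IsRainbow c M ∧ Disjoint (M.image c) U ∧ (n - #M) * w ≤ n * (2 * K + 1) := by
  obtain ⟨M₁, hM₀, hM₁, hM₁U, hcard⟩ := h.exists_initial hw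
  obtain ⟨M, ⟨hM, hMU, hlost⟩, hmax⟩ := Set.exists_max_image
    {M : Finset (A × B) | IsRainbow c M ∧ Disjoint (M.image c) U ∧
      #(M₀ \ M) + 2 * n ≤ 2 * #M + 10 * w} card
    (Set.toFinite _) ⟨M₁, hM₁, hM₁U, by rw [sdiff_eq_empty_iff_subset.2 hM₀, card_empty]; omega⟩
  refine ⟨M, hM, hMU, ?_⟩
  by_contra! hlarge
  have hMn := h.cardA ▸ hM.card_le
  obtain ⟨M', hM', hM'U, hM'card, hM'lost⟩ := h.exists_larger hM hMU (by omega) hlarge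
  have := hmax M' ⟨hM', hM'U, by omega⟩
  omega

end IsLinkedSystem

end LinkedSystem

section Rotation

lemma card_filter_mem_le_add_compl {κ ι α : Type*} [Fintype ι] [DecidableEq α]
    {π : κ → ι} {f : ι → α} {M : Finset κ} (hπ : Set.InjOn π M) (hf : Function.Injective f)
    (U V : Finset α) :
    #{i | f i ∈ U} ≤ #{p ∈ M | f (π p) ∈ U \ V} + (#(V ∩ U) + (Fintype.card ι - #M)) := by
  classical
  have hcover : ({i | f i ∈ U} : Finset ι) ⊆ ({p ∈ M | f (π p) ∈ U \ V} : Finset κ).image π ∪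
      (({i | f i ∈ V ∩ U} : Finset ι) ∪ (M.image π)ᶜ) := by
    intro i hi
    simp only [mem_union, mem_image, mem_compl, mem_filter, mem_univ, true_and, mem_inter,
      mem_sdiff] at hi ⊢
    by_cases hiV : f i ∈ V
    · tauto
    by_cases hiM : ∃ p ∈ M, π p = i
    · obtain ⟨p, hp, rfl⟩ := hiM
      exact .inl ⟨p, ⟨hp, hi, hiV⟩, rfl⟩
    · tauto
  have hV : #{i | f i ∈ V ∩ U} ≤ #(V ∩ U) :=
    card_le_card_of_injOn f (fun i hi => (mem_filter.1 hi).2) hf.injOn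
  refine (card_le_card hcover).trans ((card_union_le _ _).trans (add_le_add card_image_le ?_))
  refine (card_union_le _ _).trans (add_le_add hV ?_)
  rw [card_compl, card_image_of_injOn hπ]

lemma injOn_triple {κ ι : Type*} {f : κ → ι} {p q r : κ} (hpq : f p ≠ f q) (hpr : f p ≠ f r)
    (hqr : f q ≠ f r) : Set.InjOn f {p, q, r} := by
  rintro x (rfl | rfl | rfl) y (rfl | rfl | rfl) e
  all_goals first | rfl | exact absurd e ‹_› | exact absurd e.symm ‹_›

lemma disjoint_insert_image_sdiff {κ ι : Type*} [DecidableEq κ] [DecidableEq ι] {f : κ → ι}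
    {M P : Finset κ} {i : ι} (hf : Set.InjOn f M) (hP : P ⊆ M) (hi : i ∉ M.image f) :
    Disjoint (insert i (P.image f)) ((M \ P).image f) := by
  rw [image_sdiff_of_injOn hf hP, disjoint_insert_left]
  exact ⟨fun h => hi (mem_sdiff.1 h).1, disjoint_sdiff⟩

lemma card_filter_product_le {κ κ' : Type*} {S : Finset κ} {T : Finset κ'} {R : κ → κ' → Prop}
    [∀ p q, Decidable (R p q)] (h : ∀ p ∈ S, ∀ q ∈ T, ∀ q' ∈ T, R p q → R p q' → q = q') :
    #{x ∈ S ×ˢ T | R x.1 x.2} ≤ #S := by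
  refine card_le_card_of_injOn Prod.fst (fun x hx => (mem_product.1 (mem_filter.1 hx).1).1) ?_
  rintro ⟨p, q⟩ hx ⟨p', q'⟩ hx' (rfl : p = p')
  obtain ⟨hG, e⟩ := mem_filter.1 hx
  obtain ⟨hG', e'⟩ := mem_filter.1 hx'
  obtain ⟨hp, hq⟩ := mem_product.1 hG
  exact congrArg (p, ·) (h p hp q hq q' (mem_product.1 hG').2 e e')

variable {A B α : Type*} [DecidableEq A] [DecidableEq B] [DecidableEq α]
  {c : A × B → α} {M S T : Finset (A × B)} {p q : A × B} {a : A} {b : B}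

omit [DecidableEq α] in
lemma isRainbow_triple (hM : IsRainbow c M) (hp : p ∈ M) (hq : q ∈ M) (hpq : p ≠ q)
    (ha : a ∉ M.image Prod.fst) (hb : b ∉ M.image Prod.snd) (h₁₂ : c (a, p.2) ≠ c (p.1, q.2))
    (h₁₃ : c (a, p.2) ≠ c (q.1, b)) (h₂₃ : c (p.1, q.2) ≠ c (q.1, b)) :
    IsRainbow c {(a, p.2), (p.1, q.2), (q.1, b)} := by
  have hpa : p.1 ≠ a := ne_of_mem_of_not_mem (mem_image_of_mem _ hp) ha
  have hqa : q.1 ≠ a := ne_of_mem_of_not_mem (mem_image_of_mem _ hq) ha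
  have hpb : p.2 ≠ b := ne_of_mem_of_not_mem (mem_image_of_mem _ hp) hb
  have hqb : q.2 ≠ b := ne_of_mem_of_not_mem (mem_image_of_mem _ hq) hb
  constructor <;> rw [coe_insert, coe_pair] <;> apply injOn_triple
  exacts [hpa.symm, hqa.symm, fun h => hpq (hM.injOn_fst hp hq h),
    fun h => hpq (hM.injOn_snd hp hq h), hpb, hqb, h₁₂, h₁₃, h₂₃]

lemma exists_rotation (hM : IsRainbow c M) (hp : p ∈ M) (hq : q ∈ M)
    (ha : a ∉ M.image Prod.fst) (hb : b ∉ M.image Prod.snd) (h₁ : c (a, p.2) ∉ M.image c)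
    (h₂ : c (p.1, q.2) ∉ M.image c) (h₃ : c (q.1, b) ∉ M.image c)
    (h₁₂ : c (a, p.2) ≠ c (p.1, q.2)) (h₁₃ : c (a, p.2) ≠ c (q.1, b))
    (h₂₃ : c (p.1, q.2) ≠ c (q.1, b)) :
    ∃ M', IsRainbow c M' ∧ #M' = #M + 1 ∧
      M'.image c ⊆ {c (a, p.2), c (p.1, q.2), c (q.1, b)} ∪ M.image c := by
  have hpq : p ≠ q := by
    rintro rfl
    exact h₂ (mem_image_of_mem c hp)
  have hpqM : {p, q} ⊆ M := insert_subset hp (singleton_subset_iff.2 hq)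
  set N : Finset (A × B) := {(a, p.2), (p.1, q.2), (q.1, b)}
  have hN : IsRainbow c N := isRainbow_triple hM hp hq hpq ha hb h₁₂ h₁₃ h₂₃
  have hrow : Disjoint (N.image Prod.fst) ((M \ {p, q}).image Prod.fst) := by
    simpa only [N, image_insert, image_singleton]
      using disjoint_insert_image_sdiff hM.injOn_fst hpqM ha
  have hcolumn : Disjoint (N.image Prod.snd) ((M \ {p, q}).image Prod.snd) := by
    have hpqb : N.image Prod.snd = {b, p.2, q.2} := by
      rw [insert_comm, pair_comm b]
      simp only [N, image_insert, image_singleton]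
    simpa only [hpqb, image_insert, image_singleton]
      using disjoint_insert_image_sdiff hM.injOn_snd hpqM hb
  have hcolor : Disjoint (N.image c) ((M \ {p, q}).image c) := by
    refine Disjoint.mono_right (image_subset_image sdiff_subset) ?_
    simp only [N, image_insert, image_singleton, disjoint_insert_left, disjoint_singleton_left]
    exact ⟨h₁, h₂, h₃⟩
  refine ⟨N ∪ M \ {p, q}, hN.union (hM.mono sdiff_subset) hrow hcolumn hcolor, ?_, ?_⟩
  · have hpqcard := card_sdiff_add_card_eq_card hpqM
    have hNcard : #N = 3 := by
      rw [← card_image_of_injOn hN.injOn_color, card_eq_three]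
      exact ⟨_, _, _, h₁₂, h₁₃, h₂₃, by simp only [N, image_insert, image_singleton]⟩
    rw [card_pair hpq] at hpqcard
    rw [card_union_of_disjoint (Disjoint.of_image_finset hrow), hNcard]
    omega
  · rw [image_union]
    refine union_subset_union (by simp [N]) (image_subset_image sdiff_subset)

omit [DecidableEq A] [DecidableEq B] in
lemma card_blocked_pairs_le (hM : IsRainbow c M) (hc : IsProper c) (a : A) (b : B)
    (V : Finset α) :
    #{x ∈ M ×ˢ M | c (x.1.1, x.2.2) ∈ V ∨ c (a, x.1.2) = c (x.1.1, x.2.2) ∨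
      c (a, x.1.2) = c (x.2.1, b) ∨ c (x.1.1, x.2.2) = c (x.2.1, b)} ≤ (#V + 3) * #M := by
  classical
  have hrow {x : A} {q q' : A × B} (hq : q ∈ M) (hq' : q' ∈ M) (e : c (x, q.2) = c (x, q'.2)) :
      q = q' := hM.injOn_snd hq hq' (hc.row x e)
  have hcol {y : B} {q q' : A × B} (hq : q ∈ M) (hq' : q' ∈ M) (e : c (q.1, y) = c (q'.1, y)) :
      q = q' := hM.injOn_fst hq hq' (hc.col y e)
  have h₁ : #{x ∈ M ×ˢ M | c (x.1.1, x.2.2) ∈ V} ≤ #V * #M := by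
    rw [← card_product]
    refine card_le_card_of_injOn (fun x => (c (x.1.1, x.2.2), x.1)) ?_ ?_
    · rintro x hx
      obtain ⟨hxM, hxV⟩ := mem_filter.1 hx
      exact mem_product.2 ⟨hxV, (mem_product.1 hxM).1⟩
    · rintro ⟨p, q⟩ hx ⟨p', q'⟩ hx' e
      obtain ⟨e, rfl : p = p'⟩ := Prod.ext_iff.1 e
      have hq := (mem_product.1 (mem_filter.1 hx).1).2
      have hq' := (mem_product.1 (mem_filter.1 hx').1).2
      exact congrArg (p, ·) (hrow hq hq' e)
  have h₂ : #{x ∈ M ×ˢ M | c (a, x.1.2) = c (x.1.1, x.2.2)} ≤ #M := by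
    apply card_filter_product_le (R := fun p q : A × B => c (a, p.2) = c (p.1, q.2))
    exact fun _ _ q hq q' hq' e e' => hrow hq hq' (e.symm.trans e')
  have h₃ : #{x ∈ M ×ˢ M | c (a, x.1.2) = c (x.2.1, b)} ≤ #M := by
    apply card_filter_product_le (R := fun p q : A × B => c (a, p.2) = c (q.1, b))
    exact fun _ _ q hq q' hq' e e' => hcol hq hq' (e.symm.trans e')
  have h₄ : #{x ∈ M ×ˢ M | c (x.1.1, x.2.2) = c (x.2.1, b)} ≤ #M := by
    refine card_le_card_of_injOn Prod.snd (fun x hx => (mem_product.1 (mem_filter.1 hx).1).2) ?_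
    rintro ⟨p, q⟩ hx ⟨p', q'⟩ hx' (rfl : q = q')
    obtain ⟨h, e⟩ := mem_filter.1 hx
    obtain ⟨h', e'⟩ := mem_filter.1 hx'
    exact congrArg (·, q) <| hcol (mem_product.1 h).1 (mem_product.1 h').1 (e.trans e'.symm)
  rw [filter_or, filter_or, filter_or]
  refine (card_union_le _ _).trans ((Nat.add_le_add h₁ ((card_union_le _ _).trans
    (Nat.add_le_add h₂ ((card_union_le _ _).trans (Nat.add_le_add h₃ h₄))))).trans_eq ?_)
  ring

lemma exists_unblocked_pair (hM : IsRainbow c M) (hc : IsProper c) (hS : S ⊆ M)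
    (hT : T ⊆ M) (a : A) (b : B) {U V : Finset α}
    (hcard : (#V + 3) * #M < #{p ∈ S.image Prod.fst ×ˢ T.image Prod.snd | c p ∈ U}) :
    ∃ p ∈ S, ∃ q ∈ T, c (p.1, q.2) ∈ U ∧ c (p.1, q.2) ∉ V ∧ c (a, p.2) ≠ c (p.1, q.2) ∧
      c (a, p.2) ≠ c (q.1, b) ∧ c (p.1, q.2) ≠ c (q.1, b) := by
  by_contra! hcon
  refine (card_blocked_pairs_le hM hc a b V).not_gt (hcard.trans_le ((card_le_card ?_).trans
    (card_image_le (f := fun x : (A × B) × A × B => (x.1.1, x.2.2)))))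
  rintro ⟨x, y⟩ hxy
  simp only [mem_filter, mem_product, mem_image] at hxy
  obtain ⟨⟨⟨p, hp, rfl⟩, q, hq, rfl⟩, hU⟩ := hxy
  have := hcon p hp q hq hU
  exact mem_image.2 ⟨(p, q), mem_filter.2 ⟨mem_product.2 ⟨hS hp, hT hq⟩, by tauto⟩, rfl⟩

end Rotation

section Expander

variable {A B α : Type*} [DecidableEq α] [Fintype A] [Fintype B] {c : A × B → α}
  {M : Finset (A × B)}

/-- The cells with a colour of `U` expand: there are at least `r + s` of them on every line, and
more than `(s + 3) * n` in every rectangle with sides at least `r`. The parameter `s` measures how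
many colours of `U` may be used up. -/
structure IsExpander (c : A × B → α) (n r s : ℕ) (U : Finset α) : Prop where
  cardA : Fintype.card A = n
  cardB : Fintype.card B = n
  proper : IsProper c
  row : ∀ a, r + s ≤ #{b | c (a, b) ∈ U}
  col : ∀ b, r + s ≤ #{a | c (a, b) ∈ U}
  rect : ∀ X Y, r ≤ #X → r ≤ #Y → (s + 3) * n < #{p ∈ X ×ˢ Y | c p ∈ U}

namespace IsExpander

variable {n r s : ℕ} {U : Finset α}

lemma exists_larger (h : IsExpander c n r s U) (hM : IsRainbow c M) (hlt : #M < n)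
    (hs : #(M.image c ∩ U) + (n - #M) ≤ s) :
    ∃ M', IsRainbow c M' ∧ #M' = #M + 1 ∧ #(M'.image c ∩ U) ≤ #(M.image c ∩ U) + 3 := by
  classical
  obtain ⟨a, -, ha⟩ : ∃ a ∈ univ, a ∉ M.image Prod.fst := exists_mem_notMem_of_card_lt_card
    (card_image_le.trans_lt (hlt.trans_eq (h.cardA.symm.trans card_univ.symm)))
  obtain ⟨b, -, hb⟩ : ∃ b ∈ univ, b ∉ M.image Prod.snd := exists_mem_notMem_of_card_lt_card
    (card_image_le.trans_lt (hlt.trans_eq (h.cardB.symm.trans card_univ.symm)))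
  set S : Finset (A × B) := {p ∈ M | c (a, p.2) ∈ U \ M.image c}
  set T : Finset (A × B) := {p ∈ M | c (p.1, b) ∈ U \ M.image c}
  have hS : S ⊆ M := filter_subset _ _
  have hT : T ⊆ M := filter_subset _ _
  have hScard : r ≤ #(S.image Prod.fst) := by
    rw [card_image_of_injOn (hM.mono hS).injOn_fst]
    have hrow : r + s ≤ #S + (#(M.image c ∩ U) + (n - #M)) :=
      (h.row a).trans (h.cardB ▸
        card_filter_mem_le_add_compl hM.injOn_snd (h.proper.row a) U (M.image c))
    omega
  have hTcard : r ≤ #(T.image Prod.snd) := by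
    rw [card_image_of_injOn (hM.mono hT).injOn_snd]
    have hcol : r + s ≤ #T + (#(M.image c ∩ U) + (n - #M)) :=
      (h.col b).trans (h.cardA ▸
        card_filter_mem_le_add_compl hM.injOn_fst (h.proper.col b) U (M.image c))
    omega
  obtain ⟨p, hp, q, hq, hU, hfresh, h₁₂, h₁₃, h₂₃⟩ :=
    exists_unblocked_pair (V := M.image c ∩ U) hM h.proper hS hT a b
      ((Nat.mul_le_mul (by omega) hlt.le).trans_lt (h.rect _ _ hScard hTcard))
  obtain ⟨M', hM', hcard, hcol⟩ := exists_rotation hM (hS hp) (hT hq) ha hb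
    (mem_sdiff.1 (mem_filter.1 hp).2).2 (fun h' => hfresh (mem_inter.2 ⟨h', hU⟩))
    (mem_sdiff.1 (mem_filter.1 hq).2).2 h₁₂ h₁₃ h₂₃
  refine ⟨M', hM', hcard, ?_⟩
  have hcover := inter_subset_inter_right hcol (u := U)
  rw [union_inter_distrib_right] at hcover
  have hcard := (card_le_card hcover).trans ((card_union_le _ _).trans
    (Nat.add_le_add_right ((card_le_card inter_subset_left).trans card_le_three) _))
  rwa [add_comm] at hcard

theorem exists_perfect (h : IsExpander c n r s U) (hM : IsRainbow c M)
    (hs : #(M.image c ∩ U) + 3 * (n - #M) ≤ s) : ∃ M', IsRainbow c M' ∧ #M' = n := by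
  obtain ⟨M', ⟨hM', hs'⟩, hmax⟩ := Set.exists_max_image
    {M : Finset (A × B) | IsRainbow c M ∧ #(M.image c ∩ U) + 3 * (n - #M) ≤ s} card
    (Set.toFinite _) ⟨M, hM, hs⟩
  refine ⟨M', hM', (h.cardA ▸ hM'.card_le).eq_of_not_lt fun hlt => ?_⟩
  obtain ⟨M'', hM'', hcard, hs''⟩ := h.exists_larger hM' hlt (by omega)
  have := hmax M'' ⟨hM'', by omega⟩
  omega

end IsExpander

end Expander

section Reserve

variable {A B α : Type*} [Fintype A] [Fintype B] [DecidableEq α] {c : A × B → α} {U : Finset α}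
  {n : ℕ} {μ : ℝ}

lemma abs_le_of_pow_four_le {x y : ℝ} (hy : 0 ≤ y) (h : x ^ 4 ≤ y ^ 4) : |x| ≤ y := by
  rw [← Even.pow_abs (by decide : Even 4) x] at h
  exact le_of_pow_le_pow_left₀ (by norm_num) hy h

lemma le_mul_pow_of_le_mul_pow {C x : ℝ} {i j : ℕ} (hx : 0 ≤ x) (h₀ : 0 ≤ μ) (h₁ : μ ≤ 1)
    (hij : i ≤ j) (h : C ≤ x * μ ^ j) : C ≤ x * μ ^ i :=
  h.trans (mul_le_mul_of_nonneg_left (pow_le_pow_of_le_one h₀ h₁ hij) hx)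

lemma eighteen_mul_cube_le (hn : 288 ≤ n * μ ^ 4) : 18 * (n : ℝ) ^ 3 ≤ (μ * n / 2) ^ 4 :=
  calc 18 * (n : ℝ) ^ 3 = 288 * (n : ℝ) ^ 3 / 16 := by ring
    _ ≤ n * μ ^ 4 * (n : ℝ) ^ 3 / 16 := by gcongr
    _ = (μ * n / 2) ^ 4 := by ring

lemma eighteen_mul_pow_seven_le (hn : 18 * 2 ^ 20 ≤ n * μ ^ 12) :
    18 * (n : ℝ) ^ 7 ≤ (μ ^ 3 * n ^ 2 / 32) ^ 4 :=
  calc 18 * (n : ℝ) ^ 7 = 18 * 2 ^ 20 * (n : ℝ) ^ 7 / 2 ^ 20 := by ring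
    _ ≤ n * μ ^ 12 * (n : ℝ) ^ 7 / 2 ^ 20 := by gcongr
    _ = (μ ^ 3 * n ^ 2 / 32) ^ 4 := by ring

namespace IsReserve

lemma abs_card_row_sub_le (hU : IsReserve c μ n U) (hμ : 0 ≤ μ) (hn : 288 ≤ n * μ ^ 4) (a : A) :
    |(#{b | c (a, b) ∈ U} : ℝ) - μ * n| ≤ μ * n / 2 :=
  abs_le_of_pow_four_le (by positivity) ((hU.row a).trans (eighteen_mul_cube_le hn))

lemma abs_card_col_sub_le (hU : IsReserve c μ n U) (hμ : 0 ≤ μ) (hn : 288 ≤ n * μ ^ 4) (b : B) :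
    |(#{a | c (a, b) ∈ U} : ℝ) - μ * n| ≤ μ * n / 2 :=
  abs_le_of_pow_four_le (by positivity) ((hU.col b).trans (eighteen_mul_cube_le hn))

lemma abs_card_rect_sub_le (hU : IsReserve c μ n U) (hμ : 0 ≤ μ) (hn : 18 * 2 ^ 20 ≤ n * μ ^ 12)
    (X : Finset A) (Y : Finset B) :
    |(#{p ∈ X ×ˢ Y | c p ∈ U} : ℝ) - μ * #X * #Y| ≤ μ ^ 3 * n ^ 2 / 32 :=
  abs_le_of_pow_four_le (by positivity) ((hU.rect X Y).trans (eighteen_mul_pow_seven_le hn))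

theorem isExpander (hU : IsReserve c μ n U) (hc : IsProper c) (hA : Fintype.card A = n)
    (hB : Fintype.card B = n) (h₀ : 0 < μ) (h₁ : μ ≤ 1) (hn : 10 ^ 8 ≤ n * μ ^ 12) {k : ℕ}
    (hk : k * μ ^ 2 ≤ 11) : IsExpander c n ⌈μ * n / 4⌉₊ (3 * k) U := by
  have hpow : ∀ i ≤ 12, 10 ^ 8 ≤ n * μ ^ i := fun i hi =>
    le_mul_pow_of_le_mul_pow n.cast_nonneg h₀.le h₁ hi hn
  have hn₀ : (0 : ℝ) < n := by simpa using (by norm_num : (0 : ℝ) < 10 ^ 8).trans_le (hpow 0 bot_le)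
  have hμ₂ : μ ^ 2 ≤ 1 := pow_le_one₀ h₀.le h₁
  set r := ⌈μ * n / 4⌉₊
  have hr : μ * n / 4 ≤ r := Nat.le_ceil _
  have hr' : (r : ℝ) < μ * n / 4 + 1 := Nat.ceil_lt_add_one (by positivity)
  have hline : (r : ℝ) + 3 * k ≤ μ * n / 2 := by
    have : (3 * k + 1 : ℝ) ≤ μ * n / 4 := by
      refine le_of_mul_le_mul_right ?_ (pow_pos h₀ 2)
      linarith [hpow 3 (by norm_num)]
    linarith
  have hrect : (3 * k + 3 : ℝ) * n < μ ^ 3 * n ^ 2 / 32 := by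
    have : (3 * k + 3 : ℝ) < μ ^ 3 * n / 32 := by
      refine lt_of_mul_lt_mul_right ?_ (pow_pos h₀ 2).le
      linarith [hpow 5 (by norm_num)]
    linarith [mul_lt_mul_of_pos_right this hn₀]
  have hlarge : 288 ≤ n * μ ^ 4 := le_trans (by norm_num) (hpow 4 (by norm_num))
  refine ⟨hA, hB, hc, fun a => ?_, fun b => ?_, fun X Y hX hY => ?_⟩
  · have := (abs_le.1 (hU.abs_card_row_sub_le h₀.le hlarge a)).1
    exact_mod_cast (by linarith : (r + 3 * k : ℝ) ≤ #{b | c (a, b) ∈ U})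
  · have := (abs_le.1 (hU.abs_card_col_sub_le h₀.le hlarge b)).1
    exact_mod_cast (by linarith : (r + 3 * k : ℝ) ≤ #{a | c (a, b) ∈ U})
  · have hdev := (abs_le.1 (hU.abs_card_rect_sub_le h₀.le (hn.trans' (by norm_num)) X Y)).1
    have hXY : μ ^ 3 * n ^ 2 / 16 ≤ μ * #X * #Y :=
      calc μ ^ 3 * n ^ 2 / 16 = μ * (μ * n / 4) * (μ * n / 4) := by ring
        _ ≤ μ * #X * #Y := by
          gcongr
          · exact hr.trans (Nat.cast_le.2 hX)
          · exact hr.trans (Nat.cast_le.2 hY)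
    exact_mod_cast (by linarith : (3 * k + 3 : ℝ) * n < #{p ∈ X ×ˢ Y | c p ∈ U})

end IsReserve

end Reserve

section ManyColors

variable {κ A B α : Type*} [Fintype κ] [DecidableEq α] {n : ℕ} {d μ : ℝ} {U : Finset α}

lemma ceil_four_div_bound (h₀ : 0 < d) (h₁ : d ≤ 1) : (2 * ⌈4 / d⌉₊ + 1 : ℝ) * d ≤ 11 := by
  have hceil := Nat.ceil_lt_add_one (show 0 ≤ 4 / d by positivity)
  have := mul_lt_mul_of_pos_right hceil h₀
  rw [add_mul, div_mul_cancel₀ _ h₀.ne'] at this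
  linarith

lemma exists_injOn_rare_colors_of_dense {c : κ → α} (hd : 0 < d)
    (hc : d * Fintype.card κ ≤ #(univ.image c)) (hU : (2 * #U : ℝ) ≤ #(univ.image c)) :
    ∃ H : Finset κ, Set.InjOn c H ∧ (∀ h ∈ H, c h ∉ U) ∧
      (∀ h ∈ H, #{p | c p = c h} ≤ ⌈4 / d⌉₊) ∧ d * Fintype.card κ ≤ 4 * #H := by
  obtain ⟨H, hinj, hHU, hrare, hcard⟩ := exists_injOn_rare_colors c U ⌈4 / d⌉₊
  refine ⟨H, hinj, hHU, hrare, hc.trans ?_⟩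
  set K := ⌈4 / d⌉₊
  have hK : 4 ≤ d * K := (div_le_iff₀' hd).1 (Nat.le_ceil _)
  have hK₀ : (0 : ℝ) < K := Nat.cast_pos.2 (Nat.ceil_pos.2 (by positivity))
  have hcard' : (#(univ.image c) * K : ℝ) ≤ #H * K + #U * K + Fintype.card κ := by
    exact_mod_cast hcard
  have hκ : (4 * Fintype.card κ : ℝ) ≤ #(univ.image c) * K :=
    calc (4 * Fintype.card κ : ℝ) ≤ d * K * Fintype.card κ := by gcongr
      _ = d * Fintype.card κ * K := by ring
      _ ≤ #(univ.image c) * K := by gcongr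
  have hUK := mul_le_mul_of_nonneg_right hU hK₀.le
  refine le_of_mul_le_mul_right ?_ hK₀
  linarith

/-- The sizes for which the argument works: `n` is the order of the array, `d * n ^ 2` a lower
bound for the number of its colours, and `μ` the density of the reserve. The constant `64000` is
chosen so that `20 * (2 * (μ * n)) * n = (d * n / 40) ^ 2`, as required by
`exists_linked_matching`. -/
structure IsAdmissible (n : ℕ) (d μ : ℝ) : Prop where
  pos : 0 < d
  le_one : d ≤ 1
  density : 64000 * μ = d ^ 2
  large : 10 ^ 8 ≤ n * μ ^ 12

namespace IsAdmissible

lemma sq_le (h : IsAdmissible n d μ) : d ^ 2 ≤ d :=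
  pow_le_of_le_one h.pos.le h.le_one two_ne_zero

lemma density_pos (h : IsAdmissible n d μ) : 0 < μ := by
  linarith [h.density, pow_pos h.pos 2]

lemma density_mul_le (h : IsAdmissible n d μ) : 64000 * μ ≤ d :=
  h.density.trans_le h.sq_le

lemma density_le_one (h : IsAdmissible n d μ) : μ ≤ 1 := by
  linarith [h.density_mul_le, h.le_one, h.density_pos]

lemma large_pow (h : IsAdmissible n d μ) {i : ℕ} (hi : i ≤ 12) : 10 ^ 8 ≤ n * μ ^ i :=
  le_mul_pow_of_le_mul_pow n.cast_nonneg h.density_pos.le h.density_le_one hi h.large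

lemma order_pos (h : IsAdmissible n d μ) : (0 : ℝ) < n := by
  simpa using (by norm_num : (0 : ℝ) < 10 ^ 8).trans_le (h.large_pow (Nat.zero_le 12))

lemma ceil_le (h : IsAdmissible n d μ) : (⌈μ * n⌉₊ : ℝ) ≤ 2 * (μ * n) := by
  refine Nat.ceil_le_two_mul ?_
  linarith [h.large_pow (i := 1) (by norm_num)]

lemma le_floor (h : IsAdmissible n d μ) : d * n / 40 ≤ ⌊d * n / 20⌋₊ := by
  have hle : μ * n ≤ d * n :=
    mul_le_mul_of_nonneg_right (by linarith [h.density_mul_le, h.density_pos]) h.order_pos.le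
  have := Nat.div_two_lt_floor (a := d * n / 20) (by linarith [h.large_pow (i := 1) (by norm_num)])
  linarith

lemma mul_ceil_le (h : IsAdmissible n d μ) :
    n * (20 * ⌈μ * n⌉₊) ≤ ⌊d * n / 20⌋₊ * ⌊d * n / 20⌋₊ := by
  have : (n * (20 * ⌈μ * n⌉₊) : ℝ) ≤ ⌊d * n / 20⌋₊ * ⌊d * n / 20⌋₊ :=
    calc (n * (20 * ⌈μ * n⌉₊) : ℝ) ≤ n * (20 * (2 * (μ * n))) := by gcongr; exact h.ceil_le
      _ = 64000 * μ * n ^ 2 / 1600 := by ring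
      _ = d * n / 40 * (d * n / 40) := by rw [h.density]; ring
      _ ≤ _ := by
        have := mul_pos h.pos h.order_pos
        gcongr <;> exact h.le_floor
  exact_mod_cast this

lemma order_add_lt (h : IsAdmissible n d μ) :
    n + 14 * ⌈μ * n⌉₊ * ⌈μ * n⌉₊ < ⌊d * n / 20⌋₊ * ⌈μ * n⌉₊ := by
  have hμn : 0 < μ * n := mul_pos h.density_pos h.order_pos
  have hdn := mul_le_mul_of_nonneg_right h.density_mul_le h.order_pos.le
  have hw : μ * n ≤ ⌈μ * n⌉₊ := Nat.le_ceil _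
  have hexcess : μ * n ≤ ⌊d * n / 20⌋₊ - 14 * ⌈μ * n⌉₊ := by linarith [h.le_floor, h.ceil_le]
  have : (n : ℝ) < (⌊d * n / 20⌋₊ - 14 * ⌈μ * n⌉₊) * ⌈μ * n⌉₊ :=
    calc (n : ℝ) < 10 ^ 8 * n := by linarith [h.order_pos]
      _ ≤ n * μ ^ 2 * n := by gcongr; exact h.large_pow (by norm_num)
      _ = μ * n * (μ * n) := by ring
      _ ≤ _ := mul_le_mul hexcess hw hμn.le (hμn.le.trans hexcess)
  exact_mod_cast (by linarith : (n + 14 * ⌈μ * n⌉₊ * ⌈μ * n⌉₊ : ℝ) < ⌊d * n / 20⌋₊ * ⌈μ * n⌉₊)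

lemma mul_ceil_lt (h : IsAdmissible n d μ) :
    n * (2 * ⌈4 / d⌉₊ + 1) < 5 * ⌈μ * n⌉₊ * ⌈μ * n⌉₊ := by
  have hμ := h.density_pos
  have hn := h.order_pos
  have hμd : μ ≤ d := by linarith [h.density_mul_le]
  have : (n * (2 * ⌈4 / d⌉₊ + 1) : ℝ) < 5 * (μ * n) * (μ * n) := by
    refine lt_of_mul_lt_mul_right ?_ hμ.le
    calc (n * (2 * ⌈4 / d⌉₊ + 1) : ℝ) * μ ≤ n * ((2 * ⌈4 / d⌉₊ + 1) * d) := by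
          rw [mul_assoc]; gcongr
      _ ≤ n * 11 := by gcongr; exact ceil_four_div_bound h.pos h.le_one
      _ < n * (5 * (n * μ ^ 3)) := by
        gcongr
        linarith [h.large_pow (i := 3) (by norm_num)]
      _ = 5 * (μ * n) * (μ * n) * μ := by ring
  have hw : 5 * (μ * n) * (μ * n) ≤ 5 * ⌈μ * n⌉₊ * ⌈μ * n⌉₊ := by
    gcongr <;> exact Nat.le_ceil _
  exact_mod_cast this.trans_le hw

variable [Fintype A] [Fintype B] {c : A × B → α}

lemma exists_isLinkedSystem [DecidableEq A] [DecidableEq B] (h : IsAdmissible n d μ)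
    (hc : IsProper c) (hA : Fintype.card A = n) (hB : Fintype.card B = n)
    (hU : IsReserve c μ n U) (hUcard : (2 * #U : ℝ) ≤ #(univ.image c))
    (hcolors : d * n ^ 2 ≤ #(univ.image c)) :
    ∃ H M₀ X Y, IsLinkedSystem c n ⌈4 / d⌉₊ ⌈μ * n⌉₊ U H M₀ X Y := by
  have hκ : (Fintype.card (A × B) : ℝ) = n ^ 2 := by
    rw [Fintype.card_prod, hA, hB, sq, Nat.cast_mul]
  obtain ⟨H, hinj, hHU, hrare, hH⟩ :=
    exists_injOn_rare_colors_of_dense h.pos (hκ ▸ hcolors) hUcard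
  rw [hκ] at hH
  have hHt : 5 * ⌊d * n / 20⌋₊ * n ≤ #H := by
    have hfloor := Nat.floor_le (show 0 ≤ d * n / 20 from by
      linarith [mul_pos h.pos h.order_pos])
    have := mul_le_mul_of_nonneg_right hfloor h.order_pos.le
    exact_mod_cast (by linarith : (5 * ⌊d * n / 20⌋₊ * n : ℝ) ≤ #H)
  obtain ⟨X, Y, M₀, hM₀, hrainbow, hX, hXM, hYM, hXY⟩ := exists_linked_matching hinj
    (Nat.cast_pos.1 h.order_pos) hA hB hHt h.mul_ceil_le
  have hw : μ * n ≤ ⌈μ * n⌉₊ := Nat.le_ceil _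
  have hlarge : 288 ≤ n * μ ^ 4 := le_trans (by norm_num) (h.large_pow (by norm_num))
  refine ⟨H, M₀, X, Y, hA, hB, hc, fun a => ?_, fun b => ?_,
    Nat.ceil_pos.2 (mul_pos h.density_pos h.order_pos), hinj, hHU, hrare, hM₀, hrainbow, hXM, hYM,
    hXY, hX ▸ h.order_add_lt⟩
  · have := (abs_le.1 (hU.abs_card_row_sub_le h.density_pos.le hlarge a)).2
    exact_mod_cast (by linarith : (#{b | c (a, b) ∈ U} : ℝ) ≤ 2 * ⌈μ * n⌉₊)
  · have := (abs_le.1 (hU.abs_card_col_sub_le h.density_pos.le hlarge b)).2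
    exact_mod_cast (by linarith : (#{a | c (a, b) ∈ U} : ℝ) ≤ 2 * ⌈μ * n⌉₊)

lemma exists_almost_perfect (h : IsAdmissible n d μ) (hc : IsProper c) (hA : Fintype.card A = n)
    (hB : Fintype.card B = n) (hU : IsReserve c μ n U) (hUcard : (2 * #U : ℝ) ≤ #(univ.image c))
    (hcolors : d * n ^ 2 ≤ #(univ.image c)) :
    ∃ M, IsRainbow c M ∧ Disjoint (M.image c) U ∧ (n - #M : ℕ) * μ ^ 2 ≤ 11 := by
  classical
  obtain ⟨H, M₀, X, Y, hsys⟩ := h.exists_isLinkedSystem hc hA hB hU hUcard hcolors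
  obtain ⟨M, hM, hMU, hcard⟩ := hsys.exists_almost_perfect h.mul_ceil_lt
  refine ⟨M, hM, hMU, ?_⟩
  have hμ := h.density_pos
  have hn := h.order_pos
  have hμd : μ ≤ d := by linarith [h.density_mul_le]
  have hcard' : ((n - #M : ℕ) * ⌈μ * n⌉₊ : ℝ) ≤ n * (2 * ⌈4 / d⌉₊ + 1) := by exact_mod_cast hcard
  refine le_of_mul_le_mul_right ?_ hn
  calc (n - #M : ℕ) * μ ^ 2 * n = (n - #M : ℕ) * (μ * n) * μ := by ring
    _ ≤ (n - #M : ℕ) * ⌈μ * n⌉₊ * μ := by gcongr; exact Nat.le_ceil _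
    _ ≤ n * (2 * ⌈4 / d⌉₊ + 1) * d := by gcongr
    _ = n * ((2 * ⌈4 / d⌉₊ + 1) * d) := mul_assoc _ _ _
    _ ≤ n * 11 := by gcongr; exact ceil_four_div_bound h.pos h.le_one
    _ = 11 * n := mul_comm _ _

theorem exists_perfect (h : IsAdmissible n d μ) (hc : IsProper c) (hA : Fintype.card A = n)
    (hB : Fintype.card B = n) (hcolors : d * n ^ 2 ≤ #(univ.image c)) :
    ∃ M, IsRainbow c M ∧ #M = n := by
  have hμ := h.density_pos
  have hμ₁ : 4 * μ < 1 := by linarith [h.density_mul_le, h.le_one]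
  obtain ⟨U, -, hUcard, hU⟩ := exists_isReserve hμ (by linarith)
    (fun p => mem_image_of_mem c (mem_univ p)) hc (Nat.cast_pos.1 h.order_pos) hA hB
  have hUcard' : (2 * #U : ℝ) ≤ #(univ.image c) := by
    have := mul_le_mul_of_nonneg_right hμ₁.le (#(univ.image c)).cast_nonneg
    linarith
  obtain ⟨M, hM, hMU, hk⟩ := h.exists_almost_perfect hc hA hB hU hUcard' hcolors
  refine (hU.isExpander hc hA hB hμ h.density_le_one h.large hk).exists_perfect hM ?_
  rw [disjoint_iff_inter_eq_empty.1 hMU, card_empty, zero_add]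

end IsAdmissible

end ManyColors

section LatinArray

variable {n : ℕ} {α : Type*}

lemma IsRainbow.isTransversal {L : Matrix (Fin n) (Fin n) α} {M : Finset (Fin n × Fin n)}
    (hM : IsRainbow (fun p => L p.1 p.2) M) (hMn : #M = n) : IsTransversal L M := by
  have hfst : M.image Prod.fst = univ := by
    rw [← card_eq_iff_eq_univ, card_image_of_injOn hM.injOn_fst, hMn, Fintype.card_fin]
  have hsnd : M.image Prod.snd = univ := by
    rw [← card_eq_iff_eq_univ, card_image_of_injOn hM.injOn_snd, hMn, Fintype.card_fin]
  refine ⟨fun i => ?_, fun j => ?_, hM.injOn_color⟩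
  · obtain ⟨p, hp, rfl⟩ := mem_image.1 (hfst ▸ mem_univ i)
    exact ⟨p.2, hp, fun j hj => congrArg Prod.snd (hM.injOn_fst hj hp rfl)⟩
  · obtain ⟨p, hp, rfl⟩ := mem_image.1 (hsnd ▸ mem_univ j)
    exact ⟨p.1, hp, fun i hi => congrArg Prod.fst (hM.injOn_snd hi hp rfl)⟩

lemma IsLatinArray.exists_isTransversal {L : Matrix (Fin n) (Fin n) α} (hL : IsLatinArray L)
    {d μ : ℝ} (h : IsAdmissible n d μ) (hcolors : d * n ^ 2 ≤ ((arraySymbols L).ncard : ℝ)) :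
    ∃ T, IsTransversal L T := by
  classical
  have hcard : (arraySymbols L).ncard = #(univ.image fun p : Fin n × Fin n => L p.1 p.2) := by
    rw [arraySymbols, ← Set.ncard_coe_finset, coe_image, coe_univ, Set.image_univ]
  obtain ⟨M, hM, hMn⟩ := h.exists_perfect ⟨hL.1, hL.2⟩ (Fintype.card_fin n) (Fintype.card_fin n)
    (hcard ▸ hcolors)
  exact ⟨M, hM.isTransversal hMn⟩

end LatinArray

section Bipartite

variable {n : ℕ} {α : Type*} {T : Set (Fin n × Fin n)}

/-- The edge of the complete bipartite graph that corresponds to a cell of an array. -/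
def cellEdge (i j : Fin n) : (completeBipartiteGraph (Fin n) (Fin n)).edgeSet :=
  ⟨s(Sum.inl i, Sum.inr j), by simp⟩

lemma cellEdge_inj {i i' j j' : Fin n} : cellEdge i j = cellEdge i' j' ↔ i = i' ∧ j = j' := by
  simp [cellEdge]

lemma exists_eq_cellEdge (e : (completeBipartiteGraph (Fin n) (Fin n)).edgeSet) :
    ∃ i j, e = cellEdge i j := by
  obtain ⟨e, he⟩ := e
  induction e using Sym2.ind with
  | _ u v =>
    rcases u with i | i <;> rcases v with j | j
    · simp at he
    · exact ⟨i, j, rfl⟩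
    · exact ⟨j, i, Subtype.ext Sym2.eq_swap⟩
    · simp at he

/-- The array of colours of an edge-coloured complete bipartite graph. -/
def colorArray (c : (completeBipartiteGraph (Fin n) (Fin n)).lineGraph.Coloring α) :
    Matrix (Fin n) (Fin n) α :=
  fun i j => c (cellEdge i j)

lemma eq_of_mem_of_color_eq {V : Type*} {G : SimpleGraph V} (c : G.lineGraph.Coloring α)
    {e e' : G.edgeSet} {v : V} (hv : v ∈ (e : Sym2 V)) (hv' : v ∈ (e' : Sym2 V))
    (h : c e = c e') : e = e' :=
  by_contra fun hne => c.valid (SimpleGraph.lineGraph_adj_iff_exists.2 ⟨hne, v, hv, hv'⟩) h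

lemma isLatinArray_colorArray
    (c : (completeBipartiteGraph (Fin n) (Fin n)).lineGraph.Coloring α) :
    IsLatinArray (colorArray c) :=
  ⟨fun _ _ _ h => (cellEdge_inj.1 (eq_of_mem_of_color_eq c
      (Sym2.mem_mk_left _ _) (Sym2.mem_mk_left _ _) h)).2,
    fun _ _ _ h => (cellEdge_inj.1 (eq_of_mem_of_color_eq c
      (Sym2.mem_mk_right _ _) (Sym2.mem_mk_right _ _) h)).1⟩

lemma arraySymbols_colorArray
    (c : (completeBipartiteGraph (Fin n) (Fin n)).lineGraph.Coloring α) :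
    arraySymbols (colorArray c) = Set.range c := by
  ext γ
  constructor
  · rintro ⟨p, rfl⟩
    exact ⟨_, rfl⟩
  · rintro ⟨e, rfl⟩
    obtain ⟨i, j, rfl⟩ := exists_eq_cellEdge e
    exact ⟨(i, j), rfl⟩

/-- The spanning subgraph of the complete bipartite graph whose edges are the given cells. -/
def cellSubgraph (T : Set (Fin n × Fin n)) :
    (completeBipartiteGraph (Fin n) (Fin n)).Subgraph where
  verts := Set.univ
  Adj u v := ∃ p ∈ T, s(u, v) = cellEdge p.1 p.2
  adj_sub := by
    rintro u v ⟨p, -, h⟩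
    rw [← SimpleGraph.mem_edgeSet, h]
    exact (cellEdge p.1 p.2).2
  edge_vert _ := Set.mem_univ _
  symm := ⟨fun _ _ ⟨p, hp, h⟩ => ⟨p, hp, Sym2.eq_swap.trans h⟩⟩

lemma cellSubgraph_adj_inl {i : Fin n} {v : Fin n ⊕ Fin n} :
    (cellSubgraph T).Adj (Sum.inl i) v ↔ ∃ j, (i, j) ∈ T ∧ v = Sum.inr j := by
  simp [cellSubgraph, cellEdge]

lemma cellSubgraph_adj_inr {j : Fin n} {v : Fin n ⊕ Fin n} :
    (cellSubgraph T).Adj (Sum.inr j) v ↔ ∃ i, (i, j) ∈ T ∧ v = Sum.inl i := by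
  simp [cellSubgraph, cellEdge]

lemma cellEdge_mem_edgeSet_cellSubgraph {i j : Fin n} :
    (cellEdge i j : Sym2 (Fin n ⊕ Fin n)) ∈ (cellSubgraph T).edgeSet ↔ (i, j) ∈ T := by
  rw [cellEdge, SimpleGraph.Subgraph.mem_edgeSet, cellSubgraph_adj_inl]
  simp

lemma IsTransversal.isRainbowPerfectMatching
    {c : (completeBipartiteGraph (Fin n) (Fin n)).lineGraph.Coloring α}
    (hT : IsTransversal (colorArray c) T) : IsRainbowPerfectMatching c (cellSubgraph T) := by
  obtain ⟨hrow, hcol, hinj⟩ := hT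
  refine ⟨⟨?_, fun v => Set.mem_univ v⟩, ?_⟩
  · rintro (i | j) -
    · obtain ⟨j, hj, huniq⟩ := hrow i
      refine ⟨Sum.inr j, cellSubgraph_adj_inl.2 ⟨j, hj, rfl⟩, fun v hv => ?_⟩
      obtain ⟨j', hj', rfl⟩ := cellSubgraph_adj_inl.1 hv
      rw [huniq j' hj']
    · obtain ⟨i, hi, huniq⟩ := hcol j
      refine ⟨Sum.inl i, cellSubgraph_adj_inr.2 ⟨i, hi, rfl⟩, fun v hv => ?_⟩
      obtain ⟨i', hi', rfl⟩ := cellSubgraph_adj_inr.1 hv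
      rw [huniq i' hi']
  · intro e he e' he' h
    obtain ⟨i, j, rfl⟩ := exists_eq_cellEdge e
    obtain ⟨i', j', rfl⟩ := exists_eq_cellEdge e'
    exact cellEdge_inj.2 (Prod.mk.inj (hinj (cellEdge_mem_edgeSet_cellSubgraph.1 he)
      (cellEdge_mem_edgeSet_cellSubgraph.1 he') h))

end Bipartite

section LargeOrder

variable {β : ℝ}

lemma mul_rpow_neg_sq_pow_eq {x : ℝ} (hx : 0 < x) (C : ℝ) :
    x * ((x ^ (-β)) ^ 2 / C) ^ 12 = x ^ (1 - 24 * β) / C ^ 12 := by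
  rw [div_pow, ← pow_mul, ← Real.rpow_natCast, ← Real.rpow_mul hx.le, mul_div_assoc']
  nth_rewrite 1 [← Real.rpow_one x]
  rw [← Real.rpow_add hx]
  congr 2
  push_cast
  ring

lemma eventually_isAdmissible (h₀ : 0 < β) (h₁ : β < 1 / 24) :
    ∀ᶠ n : ℕ in Filter.atTop, (n : ℝ) ^ (-β) ≤ 1 / 2 ∧
      IsAdmissible n ((n : ℝ) ^ (-β)) (((n : ℝ) ^ (-β)) ^ 2 / 64000) := by
  have hsmall : ∀ᶠ n : ℕ in Filter.atTop, (n : ℝ) ^ (-β) ≤ 1 / 2 :=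
    ((tendsto_rpow_neg_atTop h₀).comp tendsto_natCast_atTop_atTop).eventually
      (ge_mem_nhds (by norm_num))
  -- The twelfth power of the density is of order `n ^ (-24 * β)`, hence the threshold `1 / 24`.
  have hlarge : ∀ᶠ n : ℕ in Filter.atTop, (10 ^ 8 * 64000 ^ 12 : ℝ) ≤ (n : ℝ) ^ (1 - 24 * β) :=
    ((tendsto_rpow_atTop (by linarith)).comp tendsto_natCast_atTop_atTop).eventually_ge_atTop _
  filter_upwards [Filter.eventually_gt_atTop 0, hsmall, hlarge] with n hn hsmall hlarge
  have hn₀ : (0 : ℝ) < n := Nat.cast_pos.2 hn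
  refine ⟨hsmall, Real.rpow_pos_of_pos hn₀ _, by linarith, by ring, ?_⟩
  rwa [mul_rpow_neg_sq_pow_eq hn₀, le_div_iff₀ (by positivity)]

end LargeOrder

theorem theorem1_general {β : ℝ} (h₀ : 0 < β) (h₁ : β < 1 / 24) :
    ∃ N : ℕ, ∀ n : ℕ, N ≤ n → ∀ α : Type*,
      (∀ d : ℝ, (n : ℝ) ^ (-β) < d →
        ∀ c : (completeBipartiteGraph (Fin n) (Fin n)).lineGraph.Coloring α,
          d * (n : ℝ) ^ 2 ≤ ((Set.range c).ncard : ℝ) →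
            ∃ M : (completeBipartiteGraph (Fin n) (Fin n)).Subgraph,
              IsRainbowPerfectMatching c M) ∧
      (∀ L : Matrix (Fin n) (Fin n) α, IsLatinArray L →
        (n : ℝ) ^ (2 - β) ≤ ((arraySymbols L).ncard : ℝ) → ∃ T, IsTransversal L T) ∧
      (∀ L : Matrix (Fin n) (Fin n) α, IsLatinArray L →
        (n : ℝ) ^ 2 / 2 ≤ ((arraySymbols L).ncard : ℝ) → ∃ T, IsTransversal L T) := by
  obtain ⟨N, hN⟩ := Filter.eventually_atTop.1 (eventually_isAdmissible h₀ h₁)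
  refine ⟨N, fun n hn α => ?_⟩
  obtain ⟨hhalf, hadm⟩ := hN n hn
  refine ⟨fun d hd c hc => ?_, fun L hL h => ?_, fun L hL h => ?_⟩
  · obtain ⟨T, hT⟩ := (isLatinArray_colorArray c).exists_isTransversal hadm (by
      rw [arraySymbols_colorArray]
      exact (mul_le_mul_of_nonneg_right hd.le (by positivity)).trans hc)
    exact ⟨cellSubgraph T, hT.isRainbowPerfectMatching⟩
  · refine hL.exists_isTransversal hadm (le_of_eq_of_le ?_ h)
    rw [← Real.rpow_natCast, ← Real.rpow_add hadm.order_pos, neg_add_eq_sub, Nat.cast_ofNat]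
  · refine hL.exists_isTransversal hadm (le_trans ?_ h)
    linarith [mul_le_mul_of_nonneg_right hhalf (sq_nonneg (n : ℝ))]

end RainbowMatchings

theorem theorem1 :
    ∃ N : ℕ, ∀ n : ℕ, N ≤ n → ∀ α : Type*,
      -- rainbow perfect matchings in properly edge-coloured complete bipartite graphs
      (∀ d : ℝ, (n : ℝ) ^ (-(1 / 200) : ℝ) < d →
        ∀ c : (completeBipartiteGraph (Fin n) (Fin n)).lineGraph.Coloring α,
          d * (n : ℝ) ^ 2 ≤ ((Set.range c).ncard : ℝ) →
            ∃ M : (completeBipartiteGraph (Fin n) (Fin n)).Subgraph,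
              IsRainbowPerfectMatching c M) ∧
      -- transversals in Latin arrays
      (∀ L : Matrix (Fin n) (Fin n) α, IsLatinArray L →
        (n : ℝ) ^ (399 / 200 : ℝ) ≤ ((arraySymbols L).ncard : ℝ) →
          ∃ T, IsTransversal L T) ∧
      -- in particular, the Akbari–Alipour conjecture for large orders
      (∀ L : Matrix (Fin n) (Fin n) α, IsLatinArray L →
        (n : ℝ) ^ 2 / 2 ≤ ((arraySymbols L).ncard : ℝ) →
          ∃ T, IsTransversal L T) := by
  rw [show (399 / 200 : ℝ) = 2 - 1 / 200 by norm_num]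
  exact theorem1_general (by norm_num) (by norm_num)
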